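/- Let $p\ge 1$ and $\gamma>0$, and let $Z$ be a real random variable whose law $P_Z$ has a density $p_Z$ with respect to Lebesgue measure; put $S=\{z\in\mathbb R: p_Z(z)>0\}$. Write $D(\cdot\|\cdot)$ for Kullback–Leibler divergence (natural logarithm), $I(\cdot;\cdot)$ for mutual information, $*$ for convolution and $d_{\rm TV}(P,Q)=\sup_B|P(B)-Q(B)|$ for total variation distance. Define $$\eta(A)=\sup\Big\{\tfrac{D(P*P_Z\|Q*P_Z)}{D(P\|Q)}: P,Q \text{ probability measures on }[-A,A],\ 0<D(P\|Q)<\infty\Big\},\qquad \alpha^*=\inf\{\alpha>0:\eta(1/(2\alpha))\le 1/3\},$$ $$A_2^*(t,\gamma)=\inf\{A>0: 18\gamma A^{-p}\log(A^p)\le t,\ A^p\ge\max\{e,2\gamma,\alpha^*e^3/\gamma\}\},\qquad g_d(t,\gamma)=\tfrac12\big(1-\eta(A_2^*(t,\gamma))\big)\,t .$$ Say that the non-linear strong data processing inequality (SDPI) holds with gap $g:\mathbb R\to\mathbb R$ if $$I(W;Y)\le I(W;X)-g(I(W;X))$$ for every Markov chain $W\to X\to Y$ with $Y=X+Z$, $X$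 and $Z$ independent, $Z\sim P_Z$, $\mathbb E|X|^p\le\gamma$ and $I(W;X)<\infty$ (here $W$ takes values in an arbitrary measurable space). Then the following are equivalent: 1. the non-linear SDPI holds with gap $g_d(\cdot,\gamma)$, and $g_d(t,\gamma)>0$ for all $t>0$; 2. the non-linear SDPI holds with some gap $g$ such that $g(t)>0$ for all $t>0$; 3. $\mathrm{Leb}(S\cap(S+x))>0$ for every $x\in\mathbb R$; 4. $d_{\rm TV}(P_Z,P_{Z+x})\ne 1$ for every $x\in\mathbb R$, i.e. the noise cannot be perfectly distinguished from any of its translates. -/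

import Mathlib

open MeasureTheory ProbabilityTheory InformationTheory

open scoped ENNReal

universe u v

namespace AdditiveNoiseSDPI

/-- The mutual information `I(U;V) = D(P_{UV} ‖ P_U ⊗ P_V)` in nats, with values in `[0,∞]`. -/
noncomputable def mutualInfo {Ω α β : Type*} [MeasurableSpace Ω] [MeasurableSpace α]
    [MeasurableSpace β] (μ : Measure Ω) (U : Ω → α) (V : Ω → β) : ℝ≥0∞ :=
  klDiv (μ.map fun ω => (U ω, V ω)) ((μ.map U).prod (μ.map V))

/-- `W → X → Y` is a Markov chain: `P_{WXY} = P_{WX} P_{Y|X}`, i.e. the conditional law of `Y`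
given `(W, X)` is the conditional law of `Y` given `X`. -/
def IsMarkovChain {Ω 𝒲 𝒳 : Type*} [MeasurableSpace Ω] [MeasurableSpace 𝒲] [MeasurableSpace 𝒳]
    (μ : Measure Ω) [IsFiniteMeasure μ] (W : Ω → 𝒲) (X : Ω → 𝒳) (Y : Ω → ℝ) : Prop :=
  μ.map (fun ω => ((W ω, X ω), Y ω)) =
    (μ.map fun ω => (W ω, X ω)) ⊗ₘ (condDistrib Y X μ).comap Prod.snd measurable_snd

/-- The law `P_Z` with Lebesgue density `pZ`. -/
noncomputable def noiseLaw (pZ : ℝ → ℝ) : Measure ℝ :=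
  volume.withDensity fun z => ENNReal.ofReal (pZ z)

/-- Total variation distance of probability measures, `sup_B |P(B) - Q(B)|`. -/
noncomputable def tvDist (P Q : Measure ℝ) : ℝ :=
  sSup {r : ℝ | ∃ B : Set ℝ, MeasurableSet B ∧ r = |P.real B - Q.real B|}

/-- The amplitude-constrained contraction coefficient `η(A)`: the supremum of
`D(P * P_Z ‖ Q * P_Z) / D(P ‖ Q)` over probability measures `P`, `Q` on `[-A, A]` with
`0 < D(P ‖ Q) < ∞`. By data processing this supremum is at most `1`, so that `toReal` is
harmless. -/
noncomputable def eta (ν : Measure ℝ) (A : ℝ) : ℝ :=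
  (sSup {r : ℝ≥0∞ | ∃ P Q : Measure ℝ, IsProbabilityMeasure P ∧ IsProbabilityMeasure Q ∧
    P (Set.Icc (-A) A) = 1 ∧ Q (Set.Icc (-A) A) = 1 ∧
    0 < klDiv P Q ∧ klDiv P Q < ∞ ∧
    r = klDiv (P.conv ν) (Q.conv ν) / klDiv P Q}).toReal

/-- `α* = inf {α > 0 : η(1/(2α)) ≤ 1/3}`. -/
noncomputable def alphaStar (ν : Measure ℝ) : ℝ :=
  sInf {α : ℝ | 0 < α ∧ eta ν (1 / (2 * α)) ≤ 1 / 3}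

/-- `A₂* = inf {A > 0 : 18 γ A^{-p} log (A^p) ≤ t, A^p ≥ max {e, 2γ, α* e³ / γ}}`. -/
noncomputable def A2Star (ν : Measure ℝ) (p γ t : ℝ) : ℝ :=
  sInf {A : ℝ | 0 < A ∧ 18 * γ * A ^ (-p) * Real.log (A ^ p) ≤ t ∧
    max (Real.exp 1) (max (2 * γ) (alphaStar ν * Real.exp 3 / γ)) ≤ A ^ p}

/-- `g_d(t, γ) = (1/2) (1 - η(A₂*)) t`. -/
noncomputable def gd (ν : Measure ℝ) (p γ t : ℝ) : ℝ :=
  1 / 2 * (1 - eta ν (A2Star ν p γ t)) * t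

/-- The non-linear strong data processing inequality `I(W;Y) ≤ I(W;X) - g(I(W;X))` with gap
function `g`, for all Markov chains `W → X → Y` with `Y = X + Z`, where `Z` is independent of `X`
and has law `ν`, and `E|X|^p ≤ γ`. The inequality is written additively in `[0,∞]`; for
`I(W;X) = ∞` it is void. -/
def NonlinearSDPI (ν : Measure ℝ) (p γ : ℝ) (g : ℝ → ℝ) : Prop :=
  ∀ (Ω : Type u) (𝒲 : Type v) [MeasurableSpace Ω] [MeasurableSpace 𝒲]
    (μ : Measure Ω) [IsProbabilityMeasure μ] (W : Ω → 𝒲) (X Z : Ω → ℝ),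
    Measurable W → Measurable X → Measurable Z →
    μ.map Z = ν → IndepFun X Z μ → IsMarkovChain μ W X (fun ω => X ω + Z ω) →
    ∫⁻ ω, ENNReal.ofReal (|X ω| ^ p) ∂μ ≤ ENNReal.ofReal γ →
    mutualInfo μ W (fun ω => X ω + Z ω) + ENNReal.ofReal (g (mutualInfo μ W X).toReal)
      ≤ mutualInfo μ W X

end AdditiveNoiseSDPI

namespace AdditiveNoiseSDPI

open scoped NNReal

/-! ### Divergence between finite measures: decomposition and scaling -/

section KullbackLeibler

variable {α β ι : Type*} [MeasurableSpace α] [MeasurableSpace β]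

/-! Direct part. Cut the line into cells of length `2a` and reveal the cell index of `X`. Within a
cell the input lies in an interval of half-length `a`, so the noise contracts the within-cell
divergence by `η(a)`; only the information carried by the cell index escapes contraction, and it is
at most the entropy `H` of that index. Averaging over `W` gives `I(W;Y) ≤ I(W;X) - (1 - η(a))
(I(W;X) - H)` (`mutualInfo_output_add_le`). The moment bound gives the index mean absolute value at
most `m = γ / a^p`, and Gibbs' inequality against geometric weights yields `H ≤ m (log (1/m) + 4)`
(`tsum_negMulLog_le`).

With `t = I(W;X)` and `a = A₂*`, the constraint with constant `18` makes `H ≤ t/2`, which is the gap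
`g_d`, unless `γ` is extremely small. In that case the cells are chosen with `a = 2/(γ A₂*^p)`: then
`H ≤ t/4`, and the constraint involving `α*` forces `η(a) ≤ 1/3`, so at least `t/2` is lost.

Positivity of the gap. Dobrushin's bound (`klDiv_conv_le_mul`) dominates `η(A)` by the largest total
variation distance between translates of the noise by points of `[-A, A]`. That distance is one
minus the overlap of the two densities. The overlap is continuous in the shift, so if it never
vanishes it is bounded below on a compact set, and `η(A) < 1`.

Converse. If `S` and `S + x` overlap in a null set, let `X` be `0` or `x` according to a biased coin
`W`, with the bias small enough for the moment constraint. Testing `Y ∈ S` recovers `W` almost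
surely, so no information is lost and no positive gap is possible. -/

lemma klDiv_withDensity (Q : Measure α) [IsFiniteMeasure Q] {f : α → ℝ≥0∞} (hf : Measurable f)
    [IsFiniteMeasure (Q.withDensity f)] :
    klDiv (Q.withDensity f) Q = ∫⁻ x, ENNReal.ofReal (klFun (f x).toReal) ∂Q := by
  rw [klDiv_eq_lintegral_klFun_of_ac (withDensity_absolutelyContinuous Q f)]
  refine lintegral_congr_ae ?_
  filter_upwards [Measure.rnDeriv_withDensity Q hf] with x hx
  rw [hx]

lemma klDiv_eq_tsum_restrict [Countable ι] (P Q : Measure α) [IsFiniteMeasure P]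
    [IsFiniteMeasure Q] (hPQ : P ≪ Q) {C : ι → Set α} (hC : ∀ i, MeasurableSet (C i))
    (hdisj : Pairwise (Function.onFun Disjoint C)) (hcov : ⋃ i, C i = Set.univ) :
    klDiv P Q = ∑' i, klDiv (P.restrict (C i)) (Q.restrict (C i)) := by
  have key : ∀ i, klDiv (P.restrict (C i)) (Q.restrict (C i)) =
      ∫⁻ x in C i, ENNReal.ofReal (klFun (P.rnDeriv Q x).toReal) ∂Q := by
    intro i
    have h : P.restrict (C i) = (Q.restrict (C i)).withDensity (P.rnDeriv Q) := by
      rw [← restrict_withDensity (hC i), Measure.withDensity_rnDeriv_eq P Q hPQ]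
    have : IsFiniteMeasure ((Q.restrict (C i)).withDensity (P.rnDeriv Q)) := by
      rw [← h]; infer_instance
    rw [h, klDiv_withDensity _ (Measure.measurable_rnDeriv P Q)]
  simp_rw [key]
  rw [← lintegral_iUnion hC hdisj, hcov, setLIntegral_univ, klDiv_eq_lintegral_klFun_of_ac hPQ]

/-- On finite measures `klDiv` contains the correction `Q univ - P univ`, so the mismatch of total
masses separates off as a `klFun` term. For a single cell this is the chain rule: divergence inside
the cell plus the contribution of the cell's label. -/
lemma klDiv_smul_smul (P Q : Measure α) [IsProbabilityMeasure P] [IsProbabilityMeasure Q]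
    (p q : ℝ≥0) (hq : q ≠ 0) :
    klDiv (p • P) (q • Q) = p * klDiv P Q + q * ENNReal.ofReal (klFun (p / q)) := by
  rw [klDiv_smul_right_eq_smul_left hq, smul_smul]
  set c : ℝ≥0 := q⁻¹ * p with hc
  have hcr : (p : ℝ) / q = c := by rw [hc]; push_cast; field_simp
  have hpc : (p : ℝ≥0∞) = q * c := by
    rw [hc]; norm_cast; field_simp
  suffices h : klDiv (c • P) Q = c * klDiv P Q + ENNReal.ofReal (klFun c) by
    rw [h, hcr, hpc, mul_add, mul_assoc]
  by_cases hc0 : c = 0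
  · simp [hc0, klFun_zero]
  by_cases hPQ : P ≪ Q
  swap
  · rw [klDiv_of_not_ac hPQ, klDiv_of_not_ac, ENNReal.mul_top (by simpa using hc0), top_add]
    intro h
    refine hPQ ?_
    have : P = c⁻¹ • (c • P) := by rw [smul_smul, inv_mul_cancel₀ hc0, one_smul]
    rw [this]
    exact h.smul_left _
  by_cases hint : Integrable (llr P Q) P
  swap
  · rw [klDiv_of_not_integrable hint, klDiv_of_not_integrable,
      ENNReal.mul_top (by simpa using hc0), top_add]
    intro h
    refine hint ?_
    have h2 : Integrable (llr (c • P) Q) P := by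
      have := h.smul_measure_nnreal (c := c⁻¹)
      rwa [smul_smul, inv_mul_cancel₀ hc0, one_smul] at this
    rw [integrable_congr (llr_smul_nnreal_left hPQ c hc0)] at h2
    have h3 := h2.sub (integrable_const (Real.log c))
    refine h3.congr (Filter.Eventually.of_forall fun x => ?_)
    simp
  have hne : klDiv P Q ≠ ∞ := klDiv_ne_top hPQ hint
  have hne' : klDiv (c • P) Q ≠ ∞ := by
    refine klDiv_ne_top (hPQ.smul_left c) ?_
    refine Integrable.smul_measure_nnreal ?_
    rw [integrable_congr (llr_smul_nnreal_left hPQ c hc0)]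
    exact hint.add (integrable_const _)
  rw [← ENNReal.toReal_eq_toReal_iff' hne' (by finiteness), toReal_klDiv_smul_left hPQ hint,
    ENNReal.toReal_add (by finiteness) (by finiteness), ENNReal.toReal_mul,
    ENNReal.toReal_ofReal (klFun_nonneg (NNReal.coe_nonneg c)), klFun]
  simp
  ring

/-- Conditional form of the Kullback-Leibler divergence: it is the average of the divergences
between the kernels. -/
lemma klDiv_compProd_right [MeasurableSpace.CountableOrCountablyGenerated α β] (ρ : Measure α)
    [IsFiniteMeasure ρ] (κ η : Kernel α β) [IsFiniteKernel κ] [IsFiniteKernel η] :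
    klDiv (ρ ⊗ₘ κ) (ρ ⊗ₘ η) = ∫⁻ a, klDiv (κ a) (η a) ∂ρ := by
  by_cases hac : ρ ⊗ₘ κ ≪ ρ ⊗ₘ η
  swap
  · rw [klDiv_of_not_ac hac]
    rw [Measure.absolutelyContinuous_compProd_right_iff] at hac
    symm
    have hm : MeasurableSet {a | κ a ≪ η a} := Kernel.measurableSet_absolutelyContinuous κ η
    have hpos : ρ {a | κ a ≪ η a}ᶜ ≠ 0 := fun h => hac h
    rw [eq_top_iff]
    -- Absolute continuity fails on a set of positive `ρ`-measure, where the integrand is infinite.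
    calc ∞ = ∫⁻ a in {a | κ a ≪ η a}ᶜ, ∞ ∂ρ := by
          rw [lintegral_const, Measure.restrict_apply_univ, ENNReal.top_mul hpos]
      _ ≤ ∫⁻ a in {a | κ a ≪ η a}ᶜ, klDiv (κ a) (η a) ∂ρ := by
          refine setLIntegral_mono' hm.compl fun a ha => ?_
          rw [klDiv_of_not_ac ha]
      _ ≤ _ := setLIntegral_le_lintegral _ _
  have hac' := Measure.absolutelyContinuous_compProd_right_iff.mp hac
  set f : α × β → ℝ≥0∞ := fun x => Kernel.rnDeriv κ η x.1 x.2 with hf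
  have hfm : Measurable f := Kernel.measurable_rnDeriv κ η
  have hdens : ρ ⊗ₘ κ = (ρ ⊗ₘ η).withDensity f := by
    have h1 : ρ ⊗ₘ κ = ρ ⊗ₘ (η.withDensity (Kernel.rnDeriv κ η)) := by
      refine Measure.compProd_congr ?_
      filter_upwards [hac'] with a ha
      exact (Kernel.withDensity_rnDeriv_eq ha).symm
    ext s hs
    rw [h1, withDensity_apply _ hs, ← lintegral_indicator hs, Measure.compProd_apply hs,
      Measure.lintegral_compProd (hfm.indicator hs)]
    refine lintegral_congr fun a => ?_
    rw [Kernel.withDensity_apply' _ (Kernel.measurable_rnDeriv κ η), ← lintegral_indicator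
      (measurable_prodMk_left hs)]
    rfl
  have : IsFiniteMeasure ((ρ ⊗ₘ η).withDensity f) := by rw [← hdens]; infer_instance
  rw [hdens, klDiv_withDensity _ hfm, Measure.lintegral_compProd (by fun_prop)]
  refine lintegral_congr_ae ?_
  filter_upwards [hac'] with a ha
  rw [klDiv_eq_lintegral_klFun_of_ac ha]
  refine lintegral_congr_ae ?_
  filter_upwards [Kernel.rnDeriv_eq_rnDeriv_measure (κ := κ) (η := η) (a := a)] with b hb
  rw [← hb]

end KullbackLeibler

/-! ### Data processing under convolution -/

section Convolution

lemma klDiv_conv_le (P Q ν : Measure ℝ) [IsFiniteMeasure P] [IsFiniteMeasure Q]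
    [IsProbabilityMeasure ν] : klDiv (P.conv ν) (Q.conv ν) ≤ klDiv P Q := by
  refine (klDiv_map_le _ _ measurable_add).trans ?_
  rw [← Measure.compProd_const, ← Measure.compProd_const, klDiv_compProd_left]

lemma absolutelyContinuous_conv {P Q : Measure ℝ} (ν : Measure ℝ) [SFinite P] [SFinite Q]
    [SFinite ν] (h : P ≪ Q) : P.conv ν ≪ Q.conv ν :=
  (h.prod Measure.AbsolutelyContinuous.rfl).map measurable_add

/-- Releasing the label `k X` together with `X + Z` can only increase the divergence, and once the
label is visible the divergence splits over its values. -/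
lemma klDiv_conv_le_tsum {ι : Type*} [Countable ι] [MeasurableSpace ι] [MeasurableSingletonClass ι]
    (P Q ν : Measure ℝ) [IsFiniteMeasure P] [IsFiniteMeasure Q] [IsFiniteMeasure ν]
    (hPQ : P ≪ Q) {k : ℝ → ι} (hk : Measurable k) :
    klDiv (P.conv ν) (Q.conv ν) ≤
      ∑' i, klDiv ((P.restrict (k ⁻¹' {i})).conv ν) ((Q.restrict (k ⁻¹' {i})).conv ν) := by
  set T : ℝ × ℝ → ι × ℝ := fun x => (k x.1, x.1 + x.2) with hT
  have hTm : Measurable T := by fun_prop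
  have hsnd : ∀ R : Measure ℝ, R.conv ν = ((R.prod ν).map T).map Prod.snd := fun R => by
    rw [Measure.map_map measurable_snd hTm]; rfl
  have hres : ∀ (R : Measure ℝ) [IsFiniteMeasure R] (i : ι),
      ((R.prod ν).map T).restrict (Prod.fst ⁻¹' {i}) =
        ((R.restrict (k ⁻¹' {i})).conv ν).map (fun y => (i, y)) := by
    intro R _ i
    have hset : T ⁻¹' (Prod.fst ⁻¹' {i}) = (k ⁻¹' {i}) ×ˢ Set.univ := by
      ext x; simp [hT]
    rw [Measure.restrict_map hTm (measurable_fst (measurableSet_singleton i)), hset,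
      ← Measure.prod_restrict, Measure.restrict_univ, Measure.conv,
      Measure.map_map (by fun_prop) (by fun_prop)]
    refine Measure.map_congr ?_
    have : ∀ᵐ x ∂((R.restrict (k ⁻¹' {i})).prod ν), x ∈ (k ⁻¹' {i}) ×ˢ (Set.univ : Set ℝ) := by
      have h := ae_restrict_mem (μ := R.prod ν)
        ((hk (measurableSet_singleton i)).prod MeasurableSet.univ)
      rwa [← Measure.prod_restrict, Measure.restrict_univ] at h
    filter_upwards [this] with x hx
    have : k x.1 = i := hx.1
    simp [hT, this]
  calc klDiv (P.conv ν) (Q.conv ν) ≤ klDiv ((P.prod ν).map T) ((Q.prod ν).map T) := by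
        rw [hsnd P, hsnd Q]; exact klDiv_map_le _ _ measurable_snd
    _ = ∑' i, klDiv (((P.prod ν).map T).restrict (Prod.fst ⁻¹' {i}))
          (((Q.prod ν).map T).restrict (Prod.fst ⁻¹' {i})) := by
        refine klDiv_eq_tsum_restrict _ _ ?_
          (fun i => measurable_fst (measurableSet_singleton i)) ?_ ?_
        · exact (hPQ.prod Measure.AbsolutelyContinuous.rfl).map hTm
        · intro i j hij
          exact Disjoint.preimage _ (by simpa using hij)
        · ext x; simp
    _ ≤ _ := by
        refine ENNReal.tsum_le_tsum fun i => ?_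
        rw [hres P, hres Q]
        exact klDiv_map_le _ _ measurable_prodMk_left

end Convolution

/-! ### Dobrushin contraction through hockey-stick divergences -/

section Dobrushin

/-- The weight `±1/s` in the representation of `klFun` as a mixture of hockey-stick functions. -/
noncomputable def hockeyWeight (s : ℝ) : ℝ := if 1 < s then s⁻¹ else -s⁻¹

lemma measurable_hockeyWeight : Measurable hockeyWeight :=
  Measurable.ite measurableSet_Ioi measurable_inv measurable_inv.neg

lemma hockeyWeight_mul_one_sub_nonpos {s : ℝ} (hs : 0 < s) : hockeyWeight s * (1 - s) ≤ 0 := by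
  have := inv_pos.2 hs
  unfold hockeyWeight
  split_ifs with h
  · nlinarith
  · nlinarith

lemma lintegral_div_sub_one {t : ℝ} (ht : 1 ≤ t) :
    ∫⁻ s in Set.Ioc 1 t, ENNReal.ofReal (s⁻¹ * (t - s)) = ENNReal.ofReal (klFun t) := by
  have hcont : ContinuousOn (fun s : ℝ => s⁻¹ * (t - s)) (Set.uIcc 1 t) := by
    rw [Set.uIcc_of_le ht]
    refine ContinuousOn.mul (continuousOn_inv₀.mono fun s hs => ?_) (by fun_prop)
    exact (zero_lt_one.trans_le hs.1).ne'
  rw [← ofReal_integral_eq_lintegral_ofReal, ← intervalIntegral.integral_of_le ht,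
    intervalIntegral.integral_eq_sub_of_hasDerivAt (f := fun s => t * Real.log s - s)]
  · congr 1
    simp [klFun]; ring
  · intro s hs
    rw [Set.uIcc_of_le ht] at hs
    have h0 : s ≠ 0 := (zero_lt_one.trans_le hs.1).ne'
    have h := ((Real.hasDerivAt_log h0).const_mul t).sub (hasDerivAt_id s)
    rw [show t * s⁻¹ - 1 = s⁻¹ * (t - s) by field_simp] at h
    exact h
  · exact hcont.intervalIntegrable
  · exact (intervalIntegrable_iff_integrableOn_Ioc_of_le ht).1 hcont.intervalIntegrable
  · filter_upwards [ae_restrict_mem measurableSet_Ioc] with s hs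
    have h0 : 0 < s := zero_lt_one.trans hs.1
    have := hs.2
    have := inv_pos.2 h0
    simp only [Pi.zero_apply]
    nlinarith

lemma lintegral_one_sub_div {t : ℝ} (ht0 : 0 ≤ t) (ht : t ≤ 1) :
    ∫⁻ s in Set.Ioc t 1, ENNReal.ofReal (-s⁻¹ * (t - s)) = ENNReal.ofReal (klFun t) := by
  -- At `t = 0` the interval reaches the singularity of `s⁻¹`, but there the integrand is
  -- identically `1`.
  rcases ht0.eq_or_lt with rfl | ht0
  · rw [setLIntegral_congr_fun (g := fun _ => 1) measurableSet_Ioc]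
    · simp [klFun]
    · intro s hs
      have := hs.1.ne'
      simp [this]
  have hcont : ContinuousOn (fun s : ℝ => -s⁻¹ * (t - s)) (Set.uIcc t 1) := by
    rw [Set.uIcc_of_le ht]
    refine ContinuousOn.mul (continuousOn_inv₀.mono fun s hs => ?_).neg (by fun_prop)
    exact (ht0.trans_le hs.1).ne'
  rw [← ofReal_integral_eq_lintegral_ofReal, ← intervalIntegral.integral_of_le ht,
    intervalIntegral.integral_eq_sub_of_hasDerivAt (f := fun s => s - t * Real.log s)]
  · congr 1
    simp [klFun]; ring
  · intro s hs
    rw [Set.uIcc_of_le ht] at hs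
    have h0 : s ≠ 0 := (ht0.trans_le hs.1).ne'
    have h := (hasDerivAt_id s).sub ((Real.hasDerivAt_log h0).const_mul t)
    rw [show 1 - t * s⁻¹ = -s⁻¹ * (t - s) by field_simp; ring] at h
    exact h
  · exact hcont.intervalIntegrable
  · exact (intervalIntegrable_iff_integrableOn_Ioc_of_le ht).1 hcont.intervalIntegrable
  · filter_upwards [ae_restrict_mem measurableSet_Ioc] with s hs
    have h0 : 0 < s := ht0.trans hs.1
    have := hs.1
    have := inv_pos.2 h0
    simp only [Pi.zero_apply]
    nlinarith

/-- Taylor's formula with integral remainder at `1`, where `klFun` and its derivative vanish and the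
second derivative is `1/s`. Only `s` between `1` and `t` contribute to the right-hand side. -/
lemma ofReal_klFun_eq_lintegral {t : ℝ} (ht : 0 ≤ t) :
    ENNReal.ofReal (klFun t) =
      ∫⁻ s in Set.Ioi (0 : ℝ), ENNReal.ofReal (hockeyWeight s * (t - s)) := by
  rcases le_total 1 t with h1 | h1
  · rw [← lintegral_div_sub_one h1, ← lintegral_indicator measurableSet_Ioc,
      ← lintegral_indicator measurableSet_Ioi]
    refine lintegral_congr fun s => ?_
    by_cases hs0 : 0 < s
    · have hi := inv_pos.2 hs0
      rw [Set.indicator_of_mem (Set.mem_Ioi.2 hs0)]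
      by_cases hs : s ∈ Set.Ioc 1 t
      · rw [Set.indicator_of_mem hs, hockeyWeight, if_pos hs.1]
      · rw [Set.indicator_of_notMem hs, eq_comm, ENNReal.ofReal_eq_zero, hockeyWeight]
        simp only [Set.mem_Ioc, not_and, not_le] at hs
        split_ifs with h
        · have := hs h; nlinarith
        · nlinarith
    · rw [Set.indicator_of_notMem (fun h => hs0 (by linarith [h.1])),
        Set.indicator_of_notMem (by simpa using hs0)]
  · rw [← lintegral_one_sub_div ht h1, ← lintegral_indicator measurableSet_Ioc,
      ← lintegral_indicator measurableSet_Ioi]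
    refine lintegral_congr fun s => ?_
    by_cases hs0 : 0 < s
    · have hi := inv_pos.2 hs0
      rw [Set.indicator_of_mem (Set.mem_Ioi.2 hs0)]
      by_cases hs : s ∈ Set.Ioc t 1
      · rw [Set.indicator_of_mem hs, hockeyWeight, if_neg (not_lt.2 hs.2)]
      · rw [Set.indicator_of_notMem hs, eq_comm, ENNReal.ofReal_eq_zero, hockeyWeight]
        simp only [Set.mem_Ioc, not_and, not_le] at hs
        split_ifs with h
        · nlinarith
        · have : s ≤ t := by by_contra h'; exact h (hs (not_le.1 h'))
          nlinarith
    · rw [Set.indicator_of_notMem (fun h => hs0 (by linarith [h.1])),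
        Set.indicator_of_notMem (by simpa using hs0)]

lemma klDiv_eq_lintegral_hockey {α : Type*} [MeasurableSpace α] {P Q : Measure α}
    [IsFiniteMeasure P] [IsFiniteMeasure Q] (hPQ : P ≪ Q) :
    klDiv P Q = ∫⁻ s in Set.Ioi (0 : ℝ), ∫⁻ x,
      ENNReal.ofReal (hockeyWeight s * ((P.rnDeriv Q x).toReal - s)) ∂Q := by
  have hm : Measurable fun z : α × ℝ =>
      ENNReal.ofReal (hockeyWeight z.2 * ((P.rnDeriv Q z.1).toReal - z.2)) := by
    have := measurable_hockeyWeight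
    fun_prop
  rw [klDiv_eq_lintegral_klFun_of_ac hPQ, ← lintegral_lintegral_swap hm.aemeasurable]
  refine lintegral_congr fun x => ?_
  rw [ofReal_klFun_eq_lintegral ENNReal.toReal_nonneg]

lemma conv_real_apply (P ν : Measure ℝ) [IsFiniteMeasure P] [IsFiniteMeasure ν] {B : Set ℝ}
    (hB : MeasurableSet B) : (P.conv ν).real B = ∫ x, ν.real ((x + ·) ⁻¹' B) ∂P := by
  have hm : MeasurableSet ((fun z : ℝ × ℝ => z.1 + z.2) ⁻¹' B) := measurable_add hB
  rw [measureReal_def, Measure.conv, Measure.map_apply measurable_add hB, Measure.prod_apply hm,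
    ← integral_toReal (measurable_measure_prodMk_left hm).aemeasurable
      (Filter.Eventually.of_forall fun x => measure_lt_top _ _)]
  rfl

/-- The positive part is computed by integrating over the set `B` where the output function is
positive. Pulled back to the input, this tests `φ = c (dP/dQ - s)` against `h x = ν (B - x)`, whose
oscillation on `C` is at most `θ`. Since `φ` has nonpositive mean `c (1 - s)`, the constant part of
`h` does not help. -/
lemma lintegral_hockey_conv_le {P Q ν : Measure ℝ} [IsProbabilityMeasure P]
    [IsProbabilityMeasure Q] [IsProbabilityMeasure ν] (hPQ : P ≪ Q) {C : Set ℝ}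
    (hQ : ∀ᵐ x ∂Q, x ∈ C) {θ : ℝ} (hθ : 0 ≤ θ)
    (hν : ∀ x ∈ C, ∀ y ∈ C, ∀ B, MeasurableSet B →
      ν.real ((x + ·) ⁻¹' B) ≤ ν.real ((y + ·) ⁻¹' B) + θ) {c s : ℝ} (hcs : c * (1 - s) ≤ 0) :
    ∫⁻ y, ENNReal.ofReal (c * (((P.conv ν).rnDeriv (Q.conv ν) y).toReal - s)) ∂(Q.conv ν) ≤
      ENNReal.ofReal θ * ∫⁻ x, ENNReal.ofReal (c * ((P.rnDeriv Q x).toReal - s)) ∂Q := by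
  have hPQ' := absolutelyContinuous_conv ν hPQ
  set f : ℝ → ℝ := fun x => (P.rnDeriv Q x).toReal with hf
  set f' : ℝ → ℝ := fun x => ((P.conv ν).rnDeriv (Q.conv ν) x).toReal with hf'
  have hfi : Integrable f Q := Measure.integrable_toReal_rnDeriv
  have hfi' : Integrable f' (Q.conv ν) := Measure.integrable_toReal_rnDeriv
  set B : Set ℝ := {y | 0 < c * (f' y - s)} with hBdef
  have hB : MeasurableSet B := measurableSet_lt measurable_const (by fun_prop)
  set h : ℝ → ℝ := fun x => ν.real ((x + ·) ⁻¹' B) with hh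
  have hh0 : ∀ x, 0 ≤ h x := fun x => measureReal_nonneg
  have hh1 : ∀ x, h x ≤ 1 := fun x => measureReal_le_one
  have hhm : Measurable h :=
    (measurable_measure_prodMk_left (ν := ν) (measurable_add hB)).ennreal_toReal
  have hhi : ∀ (R : Measure ℝ) [IsProbabilityMeasure R], Integrable h R := fun R _ =>
    Integrable.of_bound hhm.aestronglyMeasurable 1
      (Filter.Eventually.of_forall fun x => by
        rw [Real.norm_of_nonneg (hh0 x)]; exact hh1 x)
  have hfhi : Integrable (fun x => f x * h x) Q :=
    hfi.mul_bdd (c := 1) hhm.aestronglyMeasurable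
      (Filter.Eventually.of_forall fun x => by
        rw [Real.norm_of_nonneg (hh0 x)]; exact hh1 x)
  set φ : ℝ → ℝ := fun x => c * (f x - s) with hφ
  have hφi : Integrable φ Q := (hfi.sub (integrable_const s)).const_mul c
  have hφint : ∫ x, φ x ∂Q = c * (1 - s) := by
    rw [integral_const_mul, integral_sub hfi (integrable_const s),
      Measure.integral_toReal_rnDeriv hPQ]
    simp
  -- `m` is the infimum of `h` over `C`.
  obtain ⟨m, hm0, hm1, hm2⟩ : ∃ m, 0 ≤ m ∧ (∀ x ∈ C, m ≤ h x) ∧ ∀ x ∈ C, h x ≤ m + θ := by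
    have hbdd : BddBelow (h '' C) := ⟨0, by rintro _ ⟨x, -, rfl⟩; exact hh0 x⟩
    have hne : (h '' C).Nonempty := by
      obtain ⟨x, hx⟩ := hQ.exists
      exact ⟨_, x, hx, rfl⟩
    refine ⟨sInf (h '' C), le_csInf hne (by rintro _ ⟨x, -, rfl⟩; exact hh0 x),
      fun x hx => csInf_le hbdd ⟨x, hx, rfl⟩, fun x hx => ?_⟩
    rw [← sub_le_iff_le_add]
    refine le_csInf hne ?_
    rintro _ ⟨y, hy, rfl⟩
    rw [sub_le_iff_le_add]
    exact hν x hx y hy B hB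
  have hPh : ∫ x, h x ∂P = ∫ x, f x * h x ∂Q := (integral_rnDeriv_smul hPQ).symm
  calc ∫⁻ y, ENNReal.ofReal (c * (f' y - s)) ∂(Q.conv ν)
      = ∫⁻ y in B, ENNReal.ofReal (c * (f' y - s)) ∂(Q.conv ν) := by
        rw [← lintegral_indicator hB]
        refine lintegral_congr fun y => ?_
        by_cases hy : y ∈ B
        · rw [Set.indicator_of_mem hy]
        · rw [Set.indicator_of_notMem hy, ENNReal.ofReal_eq_zero]
          exact not_lt.1 hy
    _ = ENNReal.ofReal (∫ y in B, c * (f' y - s) ∂(Q.conv ν)) := by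
        rw [ofReal_integral_eq_lintegral_ofReal]
        · exact ((hfi'.sub (integrable_const s)).const_mul c).integrableOn
        · filter_upwards [ae_restrict_mem hB] with y hy using le_of_lt hy
    _ = ENNReal.ofReal (∫ x, φ x * h x ∂Q) := by
        congr 1
        rw [integral_const_mul, integral_sub hfi'.integrableOn (integrable_const s),
          Measure.setIntegral_toReal_rnDeriv hPQ', conv_real_apply P ν hB, hPh]
        simp only [integral_const, smul_eq_mul, measureReal_restrict_apply_univ]
        rw [conv_real_apply Q ν hB]
        have : ∀ x, φ x * h x = c * (f x * h x - h x * s) := fun x => by simp only [hφ]; ring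
        simp_rw [this]
        rw [integral_const_mul, integral_sub hfhi ((hhi Q).mul_const s), integral_mul_const]
    _ ≤ ENNReal.ofReal (∫ x, (m * φ x + θ * max (φ x) 0) ∂Q) := by
        refine ENNReal.ofReal_le_ofReal (integral_mono_ae ?_ ?_ ?_)
        · exact hφi.mul_bdd (c := 1) hhm.aestronglyMeasurable
            (Filter.Eventually.of_forall fun x => by
              rw [Real.norm_of_nonneg (hh0 x)]; exact hh1 x)
        · exact (hφi.const_mul m).add ((hφi.pos_part).const_mul θ)
        · filter_upwards [hQ] with x hx
          have h1 := hm1 x hx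
          have h2 := hm2 x hx
          rcases le_total 0 (φ x) with h0 | h0
          · simp only [max_eq_left h0]; nlinarith
          · simp only [max_eq_right h0]; nlinarith
    _ ≤ ENNReal.ofReal (θ * ∫ x, max (φ x) 0 ∂Q) := by
        refine ENNReal.ofReal_le_ofReal ?_
        rw [integral_add (hφi.const_mul m) ((hφi.pos_part).const_mul θ),
          integral_const_mul m, integral_const_mul θ, hφint]
        nlinarith
    _ = ENNReal.ofReal θ * ∫⁻ x, ENNReal.ofReal (φ x) ∂Q := by
        rw [ENNReal.ofReal_mul hθ, ofReal_integral_eq_lintegral_ofReal hφi.pos_part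
          (Filter.Eventually.of_forall fun x => le_max_right _ _)]
        congr 1
        refine lintegral_congr fun x => ?_
        rw [ENNReal.ofReal_max, ENNReal.ofReal_zero]
        simp

/-- Dobrushin's contraction of the Kullback-Leibler divergence under convolution. -/
lemma klDiv_conv_le_mul {P Q ν : Measure ℝ} [IsProbabilityMeasure P]
    [IsProbabilityMeasure Q] [IsProbabilityMeasure ν] (hPQ : P ≪ Q) {C : Set ℝ}
    (hQ : ∀ᵐ x ∂Q, x ∈ C) {θ : ℝ} (hθ : 0 ≤ θ)
    (hν : ∀ x ∈ C, ∀ y ∈ C, ∀ B, MeasurableSet B →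
      ν.real ((x + ·) ⁻¹' B) ≤ ν.real ((y + ·) ⁻¹' B) + θ) :
    klDiv (P.conv ν) (Q.conv ν) ≤ ENNReal.ofReal θ * klDiv P Q := by
  rw [klDiv_eq_lintegral_hockey hPQ, klDiv_eq_lintegral_hockey (absolutelyContinuous_conv ν hPQ),
    ← lintegral_const_mul' _ _ ENNReal.ofReal_ne_top]
  exact setLIntegral_mono' measurableSet_Ioi fun s hs =>
    lintegral_hockey_conv_le hPQ hQ hθ hν (hockeyWeight_mul_one_sub_nonpos hs)

end Dobrushin

/-! ### Basic properties of the contraction coefficient -/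

section Eta

/-- The set of ratios whose supremum defines the contraction coefficient. -/
def etaSet (ν : Measure ℝ) (A : ℝ) : Set ℝ≥0∞ :=
  {r : ℝ≥0∞ | ∃ P Q : Measure ℝ, IsProbabilityMeasure P ∧ IsProbabilityMeasure Q ∧
    P (Set.Icc (-A) A) = 1 ∧ Q (Set.Icc (-A) A) = 1 ∧
    0 < klDiv P Q ∧ klDiv P Q < ∞ ∧
    r = klDiv (P.conv ν) (Q.conv ν) / klDiv P Q}

lemma eta_nonneg (ν : Measure ℝ) (A : ℝ) : 0 ≤ eta ν A := ENNReal.toReal_nonneg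

variable (ν : Measure ℝ) [IsProbabilityMeasure ν]

lemma sSup_etaSet_le_one (A : ℝ) : sSup (etaSet ν A) ≤ 1 := by
  refine sSup_le ?_
  rintro r ⟨P, Q, hP, hQ, -, -, -, -, rfl⟩
  exact ENNReal.div_le_of_le_mul (by rw [one_mul]; exact klDiv_conv_le P Q ν)

lemma ofReal_eta (A : ℝ) : ENNReal.ofReal (eta ν A) = sSup (etaSet ν A) :=
  ENNReal.ofReal_toReal ((sSup_etaSet_le_one ν A).trans_lt ENNReal.one_lt_top).ne

lemma eta_le_one (A : ℝ) : eta ν A ≤ 1 :=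
  ENNReal.toReal_le_of_le_ofReal zero_le_one ((sSup_etaSet_le_one ν A).trans ENNReal.ofReal_one.ge)

lemma eta_mono {A B : ℝ} (h : A ≤ B) : eta ν A ≤ eta ν B := by
  refine ENNReal.toReal_mono ((sSup_etaSet_le_one ν B).trans_lt ENNReal.one_lt_top).ne
    (sSup_le_sSup ?_)
  rintro r ⟨P, Q, hP, hQ, h1, h2, h3⟩
  have hsub : Set.Icc (-A) A ⊆ Set.Icc (-B) B := Set.Icc_subset_Icc (neg_le_neg h) h
  exact ⟨P, Q, hP, hQ, le_antisymm prob_le_one (h1 ▸ measure_mono hsub),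
    le_antisymm prob_le_one (h2 ▸ measure_mono hsub), h3⟩

lemma eta_le {A θ : ℝ} (hθ : 0 ≤ θ)
    (hν : ∀ x ∈ Set.Icc (-A) A, ∀ y ∈ Set.Icc (-A) A, ∀ B, MeasurableSet B →
      ν.real ((x + ·) ⁻¹' B) ≤ ν.real ((y + ·) ⁻¹' B) + θ) : eta ν A ≤ θ := by
  refine ENNReal.toReal_le_of_le_ofReal hθ (sSup_le ?_)
  rintro r ⟨P, Q, hP, hQ, -, h2, -, h4, rfl⟩
  refine ENNReal.div_le_of_le_mul (klDiv_conv_le_mul (klDiv_ne_top_iff.1 h4.ne).1 ?_ hθ hν)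
  exact (mem_ae_iff_prob_eq_one measurableSet_Icc).2 h2

lemma klDiv_conv_le_eta_mul {A : ℝ} {P Q : Measure ℝ} [IsProbabilityMeasure P]
    [IsProbabilityMeasure Q] (hP : P (Set.Icc (-A) A) = 1) (hQ : Q (Set.Icc (-A) A) = 1)
    (h : klDiv P Q ≠ ∞) :
    klDiv (P.conv ν) (Q.conv ν) ≤ ENNReal.ofReal (eta ν A) * klDiv P Q := by
  by_cases h0 : klDiv P Q = 0
  · rw [h0, mul_zero]
    exact h0 ▸ klDiv_conv_le P Q ν
  rw [← ENNReal.div_le_iff h0 h, ofReal_eta]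
  exact le_sSup ⟨P, Q, inferInstance, inferInstance, hP, hQ, pos_iff_ne_zero.2 h0, h.lt_top, rfl⟩

/-- The contraction coefficient only depends on the length of the interval. -/
lemma klDiv_conv_le_eta_mul_of_center {A c : ℝ} {P Q : Measure ℝ} [IsProbabilityMeasure P]
    [IsProbabilityMeasure Q] (hP : P (Set.Icc (c - A) (c + A)) = 1)
    (hQ : Q (Set.Icc (c - A) (c + A)) = 1) (h : klDiv P Q ≠ ∞) :
    klDiv (P.conv ν) (Q.conv ν) ≤ ENNReal.ofReal (eta ν A) * klDiv P Q := by
  have hmv : Measurable fun x : ℝ => x - c := by fun_prop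
  have hback : ∀ R : Measure ℝ, [IsProbabilityMeasure R] →
      R.conv ν = ((R.map fun x => x - c).conv ν).map fun x => x + c := by
    intro R _
    have : IsProbabilityMeasure (R.map fun x => x - c) :=
      Measure.isProbabilityMeasure_map hmv.aemeasurable
    ext B hB
    rw [Measure.conv, Measure.conv, Measure.map_map (by fun_prop) (by fun_prop),
      Measure.map_apply (by fun_prop) hB, Measure.map_apply (by fun_prop) hB]
    have hid : ν = ν.map id := Measure.map_id.symm
    conv_rhs => rw [hid, Measure.map_prod_map R ν hmv measurable_id,
      Measure.map_apply (by fun_prop) ((by fun_prop :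
        Measurable ((fun x : ℝ => x + c) ∘ fun x : ℝ × ℝ => x.1 + x.2)) hB)]
    congr 1
    ext x
    simp only [Set.mem_preimage, Function.comp_apply, Prod.map, id]
    rw [show x.1 - c + x.2 + c = x.1 + x.2 by ring]
  have hcell : ∀ R : Measure ℝ, R (Set.Icc (c - A) (c + A)) = 1 →
      (R.map fun x => x - c) (Set.Icc (-A) A) = 1 := by
    intro R hR
    rw [Measure.map_apply hmv measurableSet_Icc, ← hR]
    congr 1
    ext x
    simp only [Set.mem_preimage, Set.mem_Icc]
    constructor <;> rintro ⟨h1, h2⟩ <;> constructor <;> linarith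
  have : IsProbabilityMeasure (P.map fun x => x - c) :=
      Measure.isProbabilityMeasure_map hmv.aemeasurable
  have : IsProbabilityMeasure (Q.map fun x => x - c) :=
      Measure.isProbabilityMeasure_map hmv.aemeasurable
  have hle := klDiv_map_le P Q hmv
  rw [hback P, hback Q]
  refine (klDiv_map_le _ _ (by fun_prop)).trans ?_
  refine (klDiv_conv_le_eta_mul ν (hcell P hP) (hcell Q hQ)
    (hle.trans_lt h.lt_top).ne).trans ?_
  gcongr

end Eta

/-! ### Overlap of the noise density with its translates -/

section Overlap

/-- The common mass of a density and its translate by `u`. -/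
noncomputable def overlap (pZ : ℝ → ℝ) (u : ℝ) : ℝ := ∫ z, min (pZ z) (pZ (z - u))

/-- Translations act continuously on `L¹`. -/
lemma continuous_integral_abs_sub_translate {p : ℝ → ℝ} (hp : Integrable p) :
    Continuous fun u : ℝ => ∫ z, |p z - p (z - u)| := by
  have : Fact ((1 : ℝ≥0∞) ≠ ∞) := ⟨ENNReal.one_ne_top⟩
  have hc : Continuous fun u : ℝ => ‖hp.toL1 p - ((DomAddAct.mk (-u)) +ᵥ (hp.toL1 p))‖ := by
    have : Continuous fun u : ℝ => (DomAddAct.mk (-u)) +ᵥ (hp.toL1 p) :=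
      (DomAddAct.continuous_mk.comp continuous_neg).vadd continuous_const
    exact (continuous_const.sub this).norm
  refine hc.congr fun u => ?_
  rw [L1.norm_eq_integral_norm]
  refine integral_congr_ae ?_
  filter_upwards [Lp.coeFn_sub (hp.toL1 p) ((DomAddAct.mk (-u)) +ᵥ (hp.toL1 p)), hp.coeFn_toL1,
    DomAddAct.vadd_Lp_ae_eq (DomAddAct.mk (-u)) (hp.toL1 p),
    (measurePreserving_add_left volume (-u)).quasiMeasurePreserving.ae hp.coeFn_toL1]
    with z h1 h2 h3 h4
  rw [h1, Pi.sub_apply, h2, h3, Real.norm_eq_abs, Equiv.symm_apply_apply, vadd_eq_add, h4,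
    neg_add_eq_sub]

variable {pZ : ℝ → ℝ}

lemma isProbabilityMeasure_noiseLaw (hprob : ∫⁻ z, ENNReal.ofReal (pZ z) = 1) :
    IsProbabilityMeasure (noiseLaw pZ) :=
  ⟨by rw [noiseLaw, withDensity_apply _ .univ, setLIntegral_univ, hprob]⟩

lemma integrable_density (hmeas : Measurable pZ) (hnonneg : ∀ z, 0 ≤ pZ z)
    (hprob : ∫⁻ z, ENNReal.ofReal (pZ z) = 1) : Integrable pZ := by
  rw [← lintegral_ofReal_ne_top_iff_integrable hmeas.aestronglyMeasurable
    (Filter.Eventually.of_forall hnonneg), hprob]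
  exact ENNReal.one_ne_top

lemma integral_density (hmeas : Measurable pZ) (hnonneg : ∀ z, 0 ≤ pZ z)
    (hprob : ∫⁻ z, ENNReal.ofReal (pZ z) = 1) : ∫ z, pZ z = 1 := by
  rw [integral_eq_lintegral_of_nonneg_ae (Filter.Eventually.of_forall hnonneg)
    hmeas.aestronglyMeasurable, hprob, ENNReal.toReal_one]

lemma noiseLaw_real_apply (hmeas : Measurable pZ) (hnonneg : ∀ z, 0 ≤ pZ z) {B : Set ℝ}
    (hB : MeasurableSet B) : (noiseLaw pZ).real B = ∫ z in B, pZ z := by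
  rw [measureReal_def, noiseLaw, withDensity_apply _ hB, integral_eq_lintegral_of_nonneg_ae
    (Filter.Eventually.of_forall hnonneg) hmeas.aestronglyMeasurable]

lemma noiseLaw_real_preimage (hmeas : Measurable pZ) (hnonneg : ∀ z, 0 ≤ pZ z) {B : Set ℝ}
    (hB : MeasurableSet B) (x : ℝ) :
    (noiseLaw pZ).real ((x + ·) ⁻¹' B) = ∫ z in B, pZ (z - x) := by
  have hB' : MeasurableSet ((x + ·) ⁻¹' B) := measurable_const_add x hB
  rw [noiseLaw_real_apply hmeas hnonneg hB', ← integral_indicator hB',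
    ← integral_sub_right_eq_self _ x, ← integral_indicator hB]
  refine integral_congr_ae (Filter.Eventually.of_forall fun z => ?_)
  have : z - x ∈ (x + ·) ⁻¹' B ↔ z ∈ B := by rw [Set.mem_preimage, add_sub_cancel]
  beta_reduce
  by_cases h : z ∈ B
  · rw [Set.indicator_of_mem h, Set.indicator_of_mem (this.2 h)]
  · rw [Set.indicator_of_notMem h, Set.indicator_of_notMem (mt this.1 h)]

lemma overlap_eq (hmeas : Measurable pZ) (hnonneg : ∀ z, 0 ≤ pZ z)
    (hprob : ∫⁻ z, ENNReal.ofReal (pZ z) = 1) (u : ℝ) :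
    overlap pZ u = 1 - 1 / 2 * ∫ z, |pZ z - pZ (z - u)| := by
  have hi := integrable_density hmeas hnonneg hprob
  have hi' := hi.comp_sub_right u
  have h1 : ∀ z, min (pZ z) (pZ (z - u)) =
      1 / 2 * (pZ z + pZ (z - u)) - 1 / 2 * |pZ z - pZ (z - u)| := fun z => by
    have h1 := min_add_max (pZ z) (pZ (z - u))
    have h2 := max_sub_min_eq_abs (pZ z) (pZ (z - u))
    rw [abs_sub_comm] at h2
    linarith
  unfold overlap
  simp_rw [h1]
  have hadd : Integrable fun z => 1 / 2 * (pZ z + pZ (z - u)) := (hi.add hi').const_mul _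
  have hsub : Integrable fun z => 1 / 2 * |pZ z - pZ (z - u)| := (hi.sub hi').abs.const_mul _
  rw [integral_sub hadd hsub, integral_const_mul,
    integral_const_mul, integral_add hi hi', integral_sub_right_eq_self pZ u,
    integral_density hmeas hnonneg hprob]
  norm_num

lemma continuous_overlap (hmeas : Measurable pZ) (hnonneg : ∀ z, 0 ≤ pZ z)
    (hprob : ∫⁻ z, ENNReal.ofReal (pZ z) = 1) : Continuous (overlap pZ) := by
  have := continuous_integral_abs_sub_translate (integrable_density hmeas hnonneg hprob)
  rw [funext (overlap_eq hmeas hnonneg hprob)]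
  fun_prop

lemma overlap_le_one (hmeas : Measurable pZ) (hnonneg : ∀ z, 0 ≤ pZ z)
    (hprob : ∫⁻ z, ENNReal.ofReal (pZ z) = 1) (u : ℝ) : overlap pZ u ≤ 1 := by
  rw [overlap_eq hmeas hnonneg hprob]
  have : 0 ≤ ∫ z, |pZ z - pZ (z - u)| := integral_nonneg fun _ => abs_nonneg _
  linarith

lemma overlap_zero (hmeas : Measurable pZ) (hnonneg : ∀ z, 0 ≤ pZ z)
    (hprob : ∫⁻ z, ENNReal.ofReal (pZ z) = 1) : overlap pZ 0 = 1 := by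
  rw [overlap_eq hmeas hnonneg hprob]
  simp

lemma integrable_min_density (hmeas : Measurable pZ) (hnonneg : ∀ z, 0 ≤ pZ z)
    (hprob : ∫⁻ z, ENNReal.ofReal (pZ z) = 1) (x y : ℝ) :
    Integrable fun z => min (pZ (z - x)) (pZ (z - y)) := by
  have hi := integrable_density hmeas hnonneg hprob
  exact (hi.comp_sub_right x).inf (hi.comp_sub_right y)

/-- The common mass is at most the mass of one translate on `B` plus the mass of the other on `Bᶜ`.
This is the input to Dobrushin's bound. -/
lemma noiseLaw_real_preimage_le (hmeas : Measurable pZ) (hnonneg : ∀ z, 0 ≤ pZ z)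
    (hprob : ∫⁻ z, ENNReal.ofReal (pZ z) = 1) (x y : ℝ) {B : Set ℝ} (hB : MeasurableSet B) :
    (noiseLaw pZ).real ((x + ·) ⁻¹' B) ≤
      (noiseLaw pZ).real ((y + ·) ⁻¹' B) + (1 - overlap pZ (y - x)) := by
  have hi := integrable_density hmeas hnonneg hprob
  have hix := hi.comp_sub_right x
  have hiy := hi.comp_sub_right y
  have him := integrable_min_density hmeas hnonneg hprob x y
  have hov : overlap pZ (y - x) = ∫ z, min (pZ (z - x)) (pZ (z - y)) := by
    rw [overlap, ← integral_sub_right_eq_self _ x]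
    simp only [sub_sub, add_sub_cancel]
  have hone : ∫ z, pZ (z - x) = 1 := by
    rw [integral_sub_right_eq_self pZ x, integral_density hmeas hnonneg hprob]
  rw [noiseLaw_real_preimage hmeas hnonneg hB, noiseLaw_real_preimage hmeas hnonneg hB, hov,
    ← integral_add_compl hB him, ← hone, ← integral_add_compl hB hix]
  have h1 : ∫ z in B, min (pZ (z - x)) (pZ (z - y)) ≤ ∫ z in B, pZ (z - y) :=
    integral_mono him.integrableOn hiy.integrableOn fun z => min_le_right _ _
  have h2 : ∫ z in Bᶜ, min (pZ (z - x)) (pZ (z - y)) ≤ ∫ z in Bᶜ, pZ (z - x) :=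
    integral_mono him.integrableOn hix.integrableOn fun z => min_le_left _ _
  linarith

lemma image_add_right_eq (pZ : ℝ → ℝ) (x : ℝ) :
    {z | 0 < pZ z} ∩ (fun z => z + x) '' {z | 0 < pZ z} = {z | 0 < pZ z ∧ 0 < pZ (z - x)} := by
  ext z
  simp [← sub_eq_add_neg]

lemma overlap_pos_iff (hmeas : Measurable pZ) (hnonneg : ∀ z, 0 ≤ pZ z)
    (hprob : ∫⁻ z, ENNReal.ofReal (pZ z) = 1) (x : ℝ) :
    0 < overlap pZ x ↔
      0 < volume ({z | 0 < pZ z} ∩ (fun z => z + x) '' {z | 0 < pZ z}) := by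
  have him := integrable_min_density hmeas hnonneg hprob 0 x
  simp only [sub_zero] at him
  rw [overlap, integral_pos_iff_support_of_nonneg (fun _ => le_min (hnonneg _) (hnonneg _)) him,
    image_add_right_eq]
  have : Function.support (fun z => min (pZ z) (pZ (z - x))) =
      {z | 0 < pZ z ∧ 0 < pZ (z - x)} := by
    ext z
    rw [Function.mem_support, Set.mem_ofPred_eq, ← lt_min_iff]
    exact (le_min (hnonneg z) (hnonneg (z - x))).lt_iff_ne'.symm
  rw [this]

lemma noiseLaw_support (hmeas : Measurable pZ)
    (hprob : ∫⁻ z, ENNReal.ofReal (pZ z) = 1) : noiseLaw pZ {z | 0 < pZ z} = 1 := by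
  have := isProbabilityMeasure_noiseLaw hprob
  have hS : MeasurableSet {z | 0 < pZ z} := measurableSet_lt measurable_const hmeas
  rw [← prob_compl_eq_zero_iff hS, noiseLaw, withDensity_apply _ hS.compl]
  rw [setLIntegral_congr_fun (g := fun _ => 0) hS.compl, lintegral_zero]
  intro z hz
  exact ENNReal.ofReal_eq_zero.2 (not_lt.1 hz)

lemma noiseLaw_preimage_support_eq_zero (hmeas : Measurable pZ)
    (hprob : ∫⁻ z, ENNReal.ofReal (pZ z) = 1) {x : ℝ}
    (h : volume ({z | 0 < pZ z} ∩ (fun z => z + x) '' {z | 0 < pZ z}) = 0) :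
    noiseLaw pZ ((x + ·) ⁻¹' {z | 0 < pZ z}) = 0 := by
  have := isProbabilityMeasure_noiseLaw hprob
  have hS : MeasurableSet {z | 0 < pZ z} := measurableSet_lt measurable_const hmeas
  have hnull : volume ((x + ·) ⁻¹' {z | 0 < pZ z} ∩ {z | 0 < pZ z}) = 0 := by
    rw [image_add_right_eq, ← measure_preimage_add volume x] at h
    convert h using 2
    ext z
    simp
  have hc : noiseLaw pZ {z | 0 < pZ z}ᶜ = 0 :=
    (prob_compl_eq_zero_iff hS).2 (noiseLaw_support hmeas hprob)
  refine measure_mono_null (t := ((x + ·) ⁻¹' {z | 0 < pZ z} ∩ {z | 0 < pZ z}) ∪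
    {z | 0 < pZ z}ᶜ) ?_ (measure_union_null (withDensity_absolutelyContinuous _ _ hnull) hc)
  intro z hz
  by_cases h' : 0 < pZ z
  · exact Or.inl ⟨hz, h'⟩
  · exact Or.inr h'

lemma tvDist_ne_one_iff (hmeas : Measurable pZ) (hnonneg : ∀ z, 0 ≤ pZ z)
    (hprob : ∫⁻ z, ENNReal.ofReal (pZ z) = 1) (x : ℝ) :
    tvDist (noiseLaw pZ) ((noiseLaw pZ).map fun z => z + x) ≠ 1 ↔
      0 < volume ({z | 0 < pZ z} ∩ (fun z => z + x) '' {z | 0 < pZ z}) := by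
  have := isProbabilityMeasure_noiseLaw hprob
  have hS : MeasurableSet {z | 0 < pZ z} := measurableSet_lt measurable_const hmeas
  have hmap : ∀ B, MeasurableSet B →
      ((noiseLaw pZ).map fun z => z + x).real B = (noiseLaw pZ).real ((x + ·) ⁻¹' B) := by
    intro B hB
    rw [measureReal_def, Measure.map_apply (measurable_add_const x) hB, measureReal_def]
    simp_rw [add_comm _ x]
  have hpre0 : ∀ B : Set ℝ, ((0 : ℝ) + ·) ⁻¹' B = B := fun B => by simp
  constructor
  · intro h
    by_contra h0
    refine h (le_antisymm (Real.sSup_le ?_ zero_le_one) ?_)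
    · rintro r ⟨B, hB, rfl⟩
      rw [hmap B hB, abs_sub_le_iff]
      have h1 : (noiseLaw pZ).real B ≤ 1 := measureReal_le_one
      have h2 : (noiseLaw pZ).real ((x + ·) ⁻¹' B) ≤ 1 := measureReal_le_one
      have h3 : 0 ≤ (noiseLaw pZ).real B := measureReal_nonneg
      have h4 : 0 ≤ (noiseLaw pZ).real ((x + ·) ⁻¹' B) := measureReal_nonneg
      constructor <;> linarith
    -- The support itself is the distinguishing set: the noise lies in it almost surely, the
    -- translated noise almost never.
    · refine le_csSup ⟨1, ?_⟩ ⟨{z | 0 < pZ z}, hS, ?_⟩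
      · rintro r ⟨B, hB, rfl⟩
        rw [hmap B hB, abs_sub_le_iff]
        have h1 : (noiseLaw pZ).real B ≤ 1 := measureReal_le_one
        have h2 : (noiseLaw pZ).real ((x + ·) ⁻¹' B) ≤ 1 := measureReal_le_one
        have h3 : 0 ≤ (noiseLaw pZ).real B := measureReal_nonneg
        have h4 : 0 ≤ (noiseLaw pZ).real ((x + ·) ⁻¹' B) := measureReal_nonneg
        constructor <;> linarith
      · rw [hmap _ hS, measureReal_def, measureReal_def, noiseLaw_support hmeas hprob,
          noiseLaw_preimage_support_eq_zero hmeas hprob (by simpa using h0)]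
        simp
  · intro h
    have hpos := (overlap_pos_iff hmeas hnonneg hprob x).2 h
    have hle := overlap_le_one hmeas hnonneg hprob x
    have hneg : overlap pZ (0 - x) = overlap pZ x := by
      rw [overlap, overlap, ← integral_sub_right_eq_self _ x]
      refine integral_congr_ae (Filter.Eventually.of_forall fun z => ?_)
      simp [min_comm]
    refine ne_of_lt (lt_of_le_of_lt (Real.sSup_le (a := 1 - overlap pZ x) ?_ ?_) ?_)
    · rintro r ⟨B, hB, rfl⟩
      rw [hmap B hB, abs_sub_le_iff]
      have h1 := noiseLaw_real_preimage_le hmeas hnonneg hprob 0 x hB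
      have h2 := noiseLaw_real_preimage_le hmeas hnonneg hprob x 0 hB
      rw [hpre0] at h1 h2
      rw [hneg] at h2
      rw [sub_zero] at h1
      constructor <;> linarith
    · linarith
    · linarith

lemma eta_lt_one (hmeas : Measurable pZ) (hnonneg : ∀ z, 0 ≤ pZ z)
    (hprob : ∫⁻ z, ENNReal.ofReal (pZ z) = 1) (hpos : ∀ x, 0 < overlap pZ x) {A : ℝ}
    (hA : 0 ≤ A) : eta (noiseLaw pZ) A < 1 := by
  have := isProbabilityMeasure_noiseLaw hprob
  -- Differences of points of `[-A, A]` fill `[-2A, 2A]`; the worst shift `u` is attained there.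
  obtain ⟨u, -, hu⟩ := (isCompact_Icc (a := -(2 * A)) (b := 2 * A)).exists_isMinOn
    (Set.nonempty_Icc.2 (by linarith)) (continuous_overlap hmeas hnonneg hprob).continuousOn
  have hu1 := overlap_le_one hmeas hnonneg hprob u
  refine lt_of_le_of_lt (eta_le (noiseLaw pZ) (θ := 1 - overlap pZ u) (by linarith) ?_)
    (by linarith [hpos u])
  intro x hx y hy B hB
  have h1 := noiseLaw_real_preimage_le hmeas hnonneg hprob x y hB
  have h2 : overlap pZ u ≤ overlap pZ (y - x) :=
    hu ⟨by linarith [hx.2, hy.1], by linarith [hx.1, hy.2]⟩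
  linarith

lemma exists_eta_le (hmeas : Measurable pZ) (hnonneg : ∀ z, 0 ≤ pZ z)
    (hprob : ∫⁻ z, ENNReal.ofReal (pZ z) = 1) {ε : ℝ} (hε : 0 < ε) :
    ∃ a, 0 < a ∧ eta (noiseLaw pZ) a ≤ ε := by
  have := isProbabilityMeasure_noiseLaw hprob
  obtain ⟨δ, hδ, h⟩ := Metric.continuousAt_iff.1
    ((continuous_overlap hmeas hnonneg hprob).continuousAt (x := (0 : ℝ))) ε hε
  refine ⟨δ / 3, by positivity, eta_le _ hε.le ?_⟩
  intro x hx y hy B hB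
  have h1 := noiseLaw_real_preimage_le hmeas hnonneg hprob x y hB
  have h2 := h (x := y - x) (by
    rw [Real.dist_eq, sub_zero, abs_lt]
    constructor <;> linarith [hx.1, hy.2, hx.2, hy.1])
  rw [Real.dist_eq, overlap_zero hmeas hnonneg hprob, abs_lt] at h2
  linarith [h2.1]

end Overlap

/-! ### Contraction cell by cell -/

section Cells

/-- The contribution `q · klFun (p / q)` of an atom to a Kullback-Leibler divergence. -/
noncomputable def atomDiv (p q : ℝ≥0∞) : ℝ≥0∞ :=
  q * ENNReal.ofReal (klFun (p.toReal / q.toReal))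

lemma measurable_atomDiv_left (q : ℝ≥0∞) : Measurable fun p => atomDiv p q := by
  unfold atomDiv
  fun_prop

/-- After normalization on `C`, both sides share the label term `atomDiv`, and only the within-cell
divergence contracts. The additive form avoids subtraction in `ℝ≥0∞`. -/
lemma klDiv_restrict_conv_add_le (P Q ν : Measure ℝ) [IsFiniteMeasure P]
    [IsFiniteMeasure Q] [IsProbabilityMeasure ν] (hPQ : P ≪ Q) {C : Set ℝ}
    {c A : ℝ} (hCA : C ⊆ Set.Icc (c - A) (c + A)) :
    klDiv ((P.restrict C).conv ν) ((Q.restrict C).conv ν) +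
        ENNReal.ofReal (1 - eta ν A) * klDiv (P.restrict C) (Q.restrict C) ≤
      klDiv (P.restrict C) (Q.restrict C) +
        ENNReal.ofReal (1 - eta ν A) * atomDiv (P C) (Q C) := by
  by_cases hq : Q C = 0
  · have hp : P C = 0 := hPQ hq
    rw [Measure.restrict_eq_zero.2 hq, Measure.restrict_eq_zero.2 hp]
    simp
  by_cases hp : P C = 0
  · rw [Measure.restrict_eq_zero.2 hp, Measure.zero_conv, klDiv_zero_left, klDiv_zero_left,
      Measure.conv, Measure.map_apply measurable_add MeasurableSet.univ, Set.preimage_univ,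
      ← Set.univ_prod_univ, Measure.prod_prod]
    simp [atomDiv, hp, klFun_zero]
  have hnorm : ∀ R : Measure ℝ, [IsFiniteMeasure R] → R C ≠ 0 →
      ∃ R' : Measure ℝ, IsProbabilityMeasure R' ∧ R' (Set.Icc (c - A) (c + A)) = 1 ∧
        R.restrict C = (R C).toNNReal • R' := by
    intro R _ hR
    have hRt : R C ≠ ∞ := measure_ne_top _ _
    have hprob := cond_isProbabilityMeasure hR
    refine ⟨R[|C], hprob, ?_, ?_⟩
    · refine le_antisymm prob_le_one ?_
      calc (1 : ℝ≥0∞) = (R C)⁻¹ * R C := (ENNReal.inv_mul_cancel hR hRt).symm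
        _ ≤ (R C)⁻¹ * R.restrict C (Set.Icc (c - A) (c + A)) := by
            refine mul_le_mul_right ?_ _
            rw [← Measure.restrict_apply_self R C]
            exact measure_mono hCA
    · ext B hB
      rw [Measure.smul_apply, ProbabilityTheory.cond, Measure.smul_apply, smul_eq_mul, ENNReal.smul_def, smul_eq_mul,
        ENNReal.coe_toNNReal hRt, ← mul_assoc, ENNReal.mul_inv_cancel hR hRt, one_mul]
  obtain ⟨P', hP', hPA, hPeq⟩ := hnorm P hp
  obtain ⟨Q', hQ', hQA, hQeq⟩ := hnorm Q hq
  have hpt : P C ≠ ∞ := measure_ne_top _ _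
  have hqt : Q C ≠ ∞ := measure_ne_top _ _
  set p := (P C).toNNReal with hpdef
  set q := (Q C).toNNReal with hqdef
  have hq0 : q ≠ 0 := ENNReal.toNNReal_ne_zero.2 ⟨hq, hqt⟩
  have hp0 : p ≠ 0 := ENNReal.toNNReal_ne_zero.2 ⟨hp, hpt⟩
  have hatom : atomDiv (P C) (Q C) = q * ENNReal.ofReal (klFun (p / q)) := by
    rw [atomDiv, ← ENNReal.coe_toNNReal hpt, ← ENNReal.coe_toNNReal hqt]
    rfl
  have hconv : ∀ (r : ℝ≥0) (R : Measure ℝ), (r • R).conv ν = r • R.conv ν := fun r R => by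
    have := Measure.conv_smul_left R ν (r : ℝ≥0∞)
    simpa using this
  rw [hPeq, hQeq, hconv, hconv, klDiv_smul_smul _ _ _ _ hq0, klDiv_smul_smul _ _ _ _ hq0, hatom]
  by_cases htop : klDiv P' Q' = ∞
  · rw [htop, ENNReal.mul_top (by simpa using hp0)]
    simp
  have h1 := klDiv_conv_le_eta_mul_of_center ν hPA hQA htop
  have h2 : ENNReal.ofReal (eta ν A) + ENNReal.ofReal (1 - eta ν A) = 1 := by
    rw [← ENNReal.ofReal_add (eta_nonneg ν A) (sub_nonneg.2 (eta_le_one ν A))]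
    simp
  set e := ENNReal.ofReal (eta ν A)
  set f := ENNReal.ofReal (1 - eta ν A)
  set D := klDiv P' Q'
  set a := (q : ℝ≥0∞) * ENNReal.ofReal (klFun (p / q))
  calc p * klDiv (P'.conv ν) (Q'.conv ν) + a + f * (p * D + a)
      ≤ p * (e * D) + a + f * (p * D + a) := by gcongr
    _ = (e + f) * (p * D) + a + f * a := by ring
    _ = p * D + a + f * a := by rw [h2, one_mul]

/-- Index of the cell of length `2a` containing `x`; the cell of index `k` is centred at `2ak`. -/
noncomputable def cellIndex (a x : ℝ) : ℤ := ⌊(x + a) / (2 * a)⌋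

lemma measurable_cellIndex (a : ℝ) : Measurable (cellIndex a) :=
  Int.measurable_floor.comp (by fun_prop)

lemma cellIndex_preimage_subset {a : ℝ} (ha : 0 < a) (k : ℤ) :
    cellIndex a ⁻¹' {k} ⊆ Set.Icc (2 * a * k - a) (2 * a * k + a) := by
  intro x hx
  have hx' : ⌊(x + a) / (2 * a)⌋ = k := hx
  rw [Int.floor_eq_iff, le_div_iff₀ (by positivity), div_lt_iff₀ (by positivity)] at hx'
  constructor <;> linarith [hx'.1, hx'.2]

/-- A point in cell `k ≠ 0` satisfies `|x| ≥ (2|k| - 1) a ≥ |k| a`. Centring a cell at `0` is what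
makes the index vanish for small `x`. -/
lemma natAbs_cellIndex_le {a p : ℝ} (ha : 0 < a) (hp : 1 ≤ p) (x : ℝ) :
    ((cellIndex a x).natAbs : ℝ) ≤ |x| ^ p / a ^ p := by
  by_cases hk : cellIndex a x = 0
  · rw [hk]; simp; positivity
  obtain ⟨h1, h2⟩ := cellIndex_preimage_subset ha (cellIndex a x) rfl
  set k := cellIndex a x
  have hk1 : (1 : ℝ) ≤ |(k : ℝ)| := by exact_mod_cast Int.one_le_abs hk
  have h3 : |(k : ℝ)| ≤ |x| / a := by
    rw [le_div_iff₀ ha]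
    rcases abs_cases (k : ℝ) with ⟨h, h'⟩ | ⟨h, h'⟩ <;> rw [h] at hk1 ⊢ <;>
      rcases abs_cases x with ⟨h4, h5⟩ | ⟨h4, h5⟩ <;> rw [h4] <;> nlinarith
  rw [← Real.div_rpow (abs_nonneg x) ha.le, Nat.cast_natAbs, Int.cast_abs]
  calc |(k : ℝ)| ≤ |x| / a := h3
    _ = (|x| / a) ^ (1 : ℝ) := (Real.rpow_one _).symm
    _ ≤ (|x| / a) ^ p := Real.rpow_le_rpow_of_exponent_le (hk1.trans h3) hp

lemma klDiv_conv_add_le (P Q ν : Measure ℝ) [IsFiniteMeasure P]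
    [IsFiniteMeasure Q] [IsProbabilityMeasure ν] {a : ℝ} (ha : 0 < a) :
    klDiv (P.conv ν) (Q.conv ν) + ENNReal.ofReal (1 - eta ν a) * klDiv P Q ≤
      klDiv P Q + ENNReal.ofReal (1 - eta ν a) *
        ∑' k : ℤ, atomDiv (P (cellIndex a ⁻¹' {k})) (Q (cellIndex a ⁻¹' {k})) := by
  by_cases hPQ : P ≪ Q
  swap
  · rw [klDiv_of_not_ac hPQ]; simp
  have hk := measurable_cellIndex a
  have hsum := klDiv_eq_tsum_restrict P Q hPQ (C := fun k : ℤ => cellIndex a ⁻¹' {k})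
    (fun k => hk (measurableSet_singleton k))
    (fun i j hij => Disjoint.preimage _ (by simpa using hij)) (by ext x; simp)
  rw [hsum, ← ENNReal.tsum_mul_left, ← ENNReal.tsum_mul_left, ← ENNReal.tsum_add]
  calc _ ≤ (∑' k : ℤ, klDiv ((P.restrict (cellIndex a ⁻¹' {k})).conv ν)
          ((Q.restrict (cellIndex a ⁻¹' {k})).conv ν)) +
        ∑' k : ℤ, ENNReal.ofReal (1 - eta ν a) *
          klDiv (P.restrict (cellIndex a ⁻¹' {k})) (Q.restrict (cellIndex a ⁻¹' {k})) := by
        gcongr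
        exact klDiv_conv_le_tsum P Q ν hPQ hk
    _ ≤ _ := by
        rw [← ENNReal.tsum_add]
        exact ENNReal.tsum_le_tsum fun k =>
          klDiv_restrict_conv_add_le P Q ν hPQ (cellIndex_preimage_subset ha k)

end Cells

/-! ### Entropy of the cell index -/

section Entropy

/-- Drops the nonpositive term `p log p`. Averaged over `p` with mean `q`, the extra summands cancel
and `-q log q` remains: information about the label is at most its entropy. -/
lemma atomDiv_add_le {p q : ℝ≥0∞} (hp : p ≤ 1) (hq : q ≤ 1) (hq0 : q ≠ 0) :
    atomDiv p q + p ≤ p * ENNReal.ofReal (-Real.log q.toReal) + q := by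
  have hpt : p ≠ ∞ := (hp.trans_lt ENNReal.one_lt_top).ne
  have hqt : q ≠ ∞ := (hq.trans_lt ENNReal.one_lt_top).ne
  obtain ⟨x, hx⟩ : ∃ x, x = p.toReal := ⟨_, rfl⟩
  obtain ⟨y, hy⟩ : ∃ y, y = q.toReal := ⟨_, rfl⟩
  have hpx : p = ENNReal.ofReal x := by rw [hx, ENNReal.ofReal_toReal hpt]
  have hqy : q = ENNReal.ofReal y := by rw [hy, ENNReal.ofReal_toReal hqt]
  have hx0 : 0 ≤ x := hx ▸ ENNReal.toReal_nonneg
  have hy0 : 0 < y := hy ▸ ENNReal.toReal_pos hq0 hqt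
  have hx1 : x ≤ 1 := by rw [hx]; exact ENNReal.toReal_le_of_le_ofReal zero_le_one (by simpa)
  have hy1 : y ≤ 1 := by rw [hy]; exact ENNReal.toReal_le_of_le_ofReal zero_le_one (by simpa)
  have hlog : 0 ≤ -Real.log y := neg_nonneg.2 (Real.log_nonpos hy0.le hy1)
  rw [atomDiv, ← hx, ← hy, hpx, hqy, ← ENNReal.ofReal_mul hy0.le, ← ENNReal.ofReal_mul hx0,
    ← ENNReal.ofReal_add (mul_nonneg hy0.le (klFun_nonneg (div_nonneg hx0 hy0.le))) hx0,
    ← ENNReal.ofReal_add (mul_nonneg hx0 hlog) hy0.le]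
  refine ENNReal.ofReal_le_ofReal ?_
  rcases hx0.eq_or_lt with rfl | hxpos
  · simp [klFun_zero]
  rw [klFun, Real.log_div hxpos.ne' hy0.ne']
  have h1 : x * Real.log x ≤ 0 := mul_nonpos_of_nonneg_of_nonpos hx0 (Real.log_nonpos hx0 hx1)
  have h2 : y * (x / y * (Real.log x - Real.log y) + 1 - x / y) =
      x * Real.log x - x * Real.log y + y - x := by field_simp
  rw [h2]
  linarith

lemma lintegral_atomDiv_le {𝒲 : Type*} [MeasurableSpace 𝒲] (ρ : Measure 𝒲)
    [IsProbabilityMeasure ρ] {p : 𝒲 → ℝ≥0∞} (hpm : Measurable p) (hp : ∀ w, p w ≤ 1) {q : ℝ≥0∞}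
    (hpq : ∫⁻ w, p w ∂ρ = q) :
    ∫⁻ w, atomDiv (p w) q ∂ρ ≤ ENNReal.ofReal (Real.negMulLog q.toReal) := by
  by_cases hq0 : q = 0
  · simp [atomDiv, hq0]
  have hq1 : q ≤ 1 := by
    rw [← hpq]
    calc ∫⁻ w, p w ∂ρ ≤ ∫⁻ _, 1 ∂ρ := lintegral_mono hp
      _ = 1 := by simp
  have hqt : q ≠ ∞ := (hq1.trans_lt ENNReal.one_lt_top).ne
  have h : ∫⁻ w, atomDiv (p w) q ∂ρ + q ≤ q * ENNReal.ofReal (-Real.log q.toReal) + q := by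
    calc ∫⁻ w, atomDiv (p w) q ∂ρ + q = ∫⁻ w, (atomDiv (p w) q + p w) ∂ρ := by
          rw [lintegral_add_right _ hpm, hpq]
      _ ≤ ∫⁻ w, (p w * ENNReal.ofReal (-Real.log q.toReal) + q) ∂ρ :=
          lintegral_mono fun w => atomDiv_add_le (hp w) hq1 hq0
      _ = q * ENNReal.ofReal (-Real.log q.toReal) + q := by
          rw [lintegral_add_right _ measurable_const, lintegral_mul_const _ hpm, hpq]
          simp
  refine ((ENNReal.add_le_add_iff_right hqt).1 h).trans_eq ?_
  nth_rw 1 [← ENNReal.ofReal_toReal hqt]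
  rw [← ENNReal.ofReal_mul ENNReal.toReal_nonneg, Real.negMulLog]
  congr 1
  ring

lemma tsum_ofReal_pow_natAbs {m : ℝ} (hm0 : 0 ≤ m) (hm1 : m < 1) :
    ∑' k : ℤ, ENNReal.ofReal m ^ k.natAbs = ENNReal.ofReal (1 + 2 * m / (1 - m)) := by
  have h1 : HasSum (fun n : ℕ => m ^ (n : ℤ).natAbs) (1 - m)⁻¹ := by
    simpa using hasSum_geometric_of_lt_one hm0 hm1
  have h2 : HasSum (fun n : ℕ => m ^ (-((n : ℤ) + 1)).natAbs) (m * (1 - m)⁻¹) := by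
    have := (hasSum_geometric_of_lt_one hm0 hm1).mul_left m
    refine this.congr_fun ?_
    intro n
    rw [Int.natAbs_neg, ← Nat.cast_succ, Int.natAbs_natCast, pow_succ']
  have h := HasSum.of_nat_of_neg_add_one (f := fun k : ℤ => m ^ k.natAbs) h1 h2
  have hm : 1 - m ≠ 0 := by linarith
  rw [show 1 + 2 * m / (1 - m) = (1 - m)⁻¹ + m * (1 - m)⁻¹ by field_simp; ring, ← h.tsum_eq,
    ENNReal.ofReal_tsum_of_nonneg (fun k => by positivity) h.summable]
  simp_rw [ENNReal.ofReal_pow hm0]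

/-- One term of Gibbs' inequality, from `log u ≤ u - 1` at `u = r / q`; the weights `r` need not sum
to one. -/
lemma negMulLog_add_le {q r : ℝ} (hq : 0 ≤ q) (hr : 0 < r) :
    Real.negMulLog q + q ≤ q * -Real.log r + r := by
  rcases hq.eq_or_lt with rfl | hq
  · simp [hr.le]
  have h := Real.log_le_sub_one_of_pos (div_pos hr hq)
  rw [Real.log_div hr.ne' hq.ne'] at h
  have := mul_le_mul_of_nonneg_left h hq.le
  rw [mul_sub, mul_sub, mul_div_cancel₀ _ hq.ne'] at this
  rw [Real.negMulLog]
  linarith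

/-- An integer-valued random variable with small first moment has small entropy. -/
lemma tsum_negMulLog_le {q : ℤ → ℝ≥0∞} (hq : ∑' k, q k = 1) {m : ℝ} (hm0 : 0 < m)
    (hm : m ≤ 1 / 2) (hmom : ∑' k : ℤ, (k.natAbs : ℝ≥0∞) * q k ≤ ENNReal.ofReal m) :
    ∑' k, ENNReal.ofReal (Real.negMulLog (q k).toReal) ≤
      ENNReal.ofReal (m * (-Real.log m + 4)) := by
  have hlog : 0 ≤ -Real.log m := neg_nonneg.2 (Real.log_nonpos hm0.le (by linarith))
  have hq1 : ∀ k, q k ≤ 1 := fun k => hq ▸ ENNReal.le_tsum k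
  have hqt : ∀ k, q k ≠ ∞ := fun k => ((hq1 k).trans_lt ENNReal.one_lt_top).ne
  -- Gibbs' inequality with reference weight `m ^ |k|`. These weights sum to `1 + 2m/(1-m) ≤ 1 +
  -- 4m`, the source of the constant `4`.
  have hterm : ∀ k : ℤ, ENNReal.ofReal (Real.negMulLog (q k).toReal) + q k ≤
      ENNReal.ofReal (-Real.log m) * (k.natAbs * q k) + ENNReal.ofReal m ^ k.natAbs := by
    intro k
    have h := negMulLog_add_le (q := (q k).toReal) ENNReal.toReal_nonneg
      (pow_pos hm0 k.natAbs)
    have h0 : 0 ≤ Real.negMulLog (q k).toReal := Real.negMulLog_nonneg ENNReal.toReal_nonneg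
      (ENNReal.toReal_le_of_le_ofReal zero_le_one (by simpa using hq1 k))
    rw [← ENNReal.ofReal_toReal (hqt k), ENNReal.toReal_ofReal ENNReal.toReal_nonneg,
      ← ENNReal.ofReal_add h0 ENNReal.toReal_nonneg, ← ENNReal.ofReal_natCast,
      ← ENNReal.ofReal_mul (Nat.cast_nonneg _), ← ENNReal.ofReal_mul hlog,
      ← ENNReal.ofReal_pow hm0.le, ← ENNReal.ofReal_add (by positivity) (by positivity)]
    refine ENNReal.ofReal_le_ofReal (h.trans_eq ?_)
    rw [Real.log_pow]
    ring
  have hsum := ENNReal.tsum_le_tsum hterm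
  rw [ENNReal.tsum_add, ENNReal.tsum_add, hq, ENNReal.tsum_mul_left,
    tsum_ofReal_pow_natAbs hm0.le (by linarith)] at hsum
  have hfin : ENNReal.ofReal (-Real.log m) * ∑' k : ℤ, (k.natAbs : ℝ≥0∞) * q k +
      ENNReal.ofReal (1 + 2 * m / (1 - m)) ≤ ENNReal.ofReal (m * (-Real.log m + 4)) + 1 := by
    calc _ ≤ ENNReal.ofReal (-Real.log m) * ENNReal.ofReal m +
          ENNReal.ofReal (1 + 2 * m / (1 - m)) := by gcongr
      _ ≤ _ := by
        rw [← ENNReal.ofReal_mul hlog, ← ENNReal.ofReal_one,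
          ← ENNReal.ofReal_add (by positivity) (by
            have : 0 < 1 - m := by linarith
            positivity), ← ENNReal.ofReal_add (by positivity) zero_le_one]
        refine ENNReal.ofReal_le_ofReal ?_
        have : 2 * m / (1 - m) ≤ 4 * m := by
          rw [div_le_iff₀ (by linarith)]; nlinarith
        linarith
  exact (ENNReal.add_le_add_iff_right ENNReal.one_ne_top).1 (hsum.trans hfin)

lemma tsum_natAbs_mul_cell_le (Q : Measure ℝ) {a p γ : ℝ} (ha : 0 < a) (hp : 1 ≤ p)
    (hγ : 0 ≤ γ) (hQ : ∫⁻ x, ENNReal.ofReal (|x| ^ p) ∂Q ≤ ENNReal.ofReal γ) :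
    ∑' k : ℤ, (k.natAbs : ℝ≥0∞) * Q (cellIndex a ⁻¹' {k}) ≤ ENNReal.ofReal (γ / a ^ p) := by
  have hk := measurable_cellIndex a
  have hC : ∀ k : ℤ, MeasurableSet (cellIndex a ⁻¹' {k}) :=
    fun k => hk (measurableSet_singleton k)
  calc ∑' k : ℤ, (k.natAbs : ℝ≥0∞) * Q (cellIndex a ⁻¹' {k})
      ≤ ∑' k : ℤ, ∫⁻ x in cellIndex a ⁻¹' {k}, ENNReal.ofReal (|x| ^ p / a ^ p) ∂Q := by
        refine ENNReal.tsum_le_tsum fun k => ?_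
        rw [← setLIntegral_const]
        refine setLIntegral_mono' (hC k) fun x hx => ?_
        have hx' : cellIndex a x = k := hx
        rw [← ENNReal.ofReal_natCast, ← hx']
        exact ENNReal.ofReal_le_ofReal (natAbs_cellIndex_le ha hp x)
    _ = ∫⁻ x, ENNReal.ofReal (|x| ^ p / a ^ p) ∂Q := by
        rw [← lintegral_iUnion hC (fun i j hij => Disjoint.preimage _ (by simpa using hij)),
          show ⋃ k, cellIndex a ⁻¹' {k} = Set.univ by ext x; simp, setLIntegral_univ]
    _ = (∫⁻ x, ENNReal.ofReal (|x| ^ p) ∂Q) * ENNReal.ofReal (a ^ p)⁻¹ := by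
        rw [← lintegral_mul_const' _ _ ENNReal.ofReal_ne_top]
        refine lintegral_congr fun x => ?_
        rw [← ENNReal.ofReal_mul (by positivity), div_eq_mul_inv]
    _ ≤ ENNReal.ofReal (γ / a ^ p) := by
        rw [div_eq_mul_inv, ENNReal.ofReal_mul hγ]
        gcongr

end Entropy

/-! ### Averaging over the message -/

section Averaging

lemma lintegral_klDiv_conv_add_le {𝒲 : Type*} [MeasurableSpace 𝒲] (ρ : Measure 𝒲)
    [IsProbabilityMeasure ρ] (K : Kernel 𝒲 ℝ) [IsMarkovKernel K] (Q ν : Measure ℝ)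
    [IsProbabilityMeasure Q] [IsProbabilityMeasure ν]
    (hQ : ∀ B, MeasurableSet B → ∫⁻ w, K w B ∂ρ = Q B) {a p γ : ℝ} (ha : 0 < a) (hp : 1 ≤ p)
    (hmom : ∫⁻ x, ENNReal.ofReal (|x| ^ p) ∂Q ≤ ENNReal.ofReal γ) {m : ℝ} (hm0 : 0 < m)
    (hm : m ≤ 1 / 2) (hγ : 0 ≤ γ) (hγm : γ / a ^ p ≤ m) :
    ∫⁻ w, klDiv ((K w).conv ν) (Q.conv ν) ∂ρ +
        ENNReal.ofReal (1 - eta ν a) * ∫⁻ w, klDiv (K w) Q ∂ρ ≤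
      ∫⁻ w, klDiv (K w) Q ∂ρ +
        ENNReal.ofReal (1 - eta ν a) * ENNReal.ofReal (m * (-Real.log m + 4)) := by
  have hk := measurable_cellIndex a
  have hC : ∀ k : ℤ, MeasurableSet (cellIndex a ⁻¹' {k}) :=
    fun k => hk (measurableSet_singleton k)
  have hmeas : ∀ k : ℤ, Measurable fun w =>
      atomDiv (K w (cellIndex a ⁻¹' {k})) (Q (cellIndex a ⁻¹' {k})) := fun k =>
    (measurable_atomDiv_left _).comp (K.measurable_coe (hC k))
  have hone : ∑' k : ℤ, Q (cellIndex a ⁻¹' {k}) = 1 := by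
    rw [← measure_iUnion (fun i j hij => Disjoint.preimage _ (by simpa using hij)) hC,
      show ⋃ k, cellIndex a ⁻¹' {k} = Set.univ by ext x; simp, measure_univ]
  have hH : ∑' k : ℤ, ∫⁻ w, atomDiv (K w (cellIndex a ⁻¹' {k})) (Q (cellIndex a ⁻¹' {k})) ∂ρ ≤
      ENNReal.ofReal (m * (-Real.log m + 4)) :=
    (ENNReal.tsum_le_tsum fun k => lintegral_atomDiv_le ρ (K.measurable_coe (hC k))
      (fun w => prob_le_one) (hQ _ (hC k))).trans
      (tsum_negMulLog_le hone hm0 hm ((tsum_natAbs_mul_cell_le Q ha hp hγ hmom).trans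
        (ENNReal.ofReal_le_ofReal hγm)))
  set f := ENNReal.ofReal (1 - eta ν a)
  -- Superadditivity and scaling of the lower integral point the right way, so measurability of `w ↦
  -- klDiv (K w) Q` is not needed; only the label terms must be measurable.
  calc _ ≤ ∫⁻ w, klDiv ((K w).conv ν) (Q.conv ν) ∂ρ + ∫⁻ w, f * klDiv (K w) Q ∂ρ := by
        gcongr
        exact lintegral_const_mul_le _ _
    _ ≤ ∫⁻ w, (klDiv ((K w).conv ν) (Q.conv ν) + f * klDiv (K w) Q) ∂ρ := le_lintegral_add _ _
    _ ≤ ∫⁻ w, (klDiv (K w) Q + f *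
          ∑' k : ℤ, atomDiv (K w (cellIndex a ⁻¹' {k})) (Q (cellIndex a ⁻¹' {k}))) ∂ρ :=
        lintegral_mono fun w => klDiv_conv_add_le (K w) Q ν ha
    _ = ∫⁻ w, klDiv (K w) Q ∂ρ + f * ∑' k : ℤ, ∫⁻ w,
          atomDiv (K w (cellIndex a ⁻¹' {k})) (Q (cellIndex a ⁻¹' {k})) ∂ρ := by
        rw [lintegral_add_right _ ((Measurable.tsum hmeas).const_mul f),
          lintegral_const_mul _ (Measurable.tsum hmeas),
          lintegral_tsum fun k => (hmeas k).aemeasurable]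
    _ ≤ _ := by gcongr

end Averaging

/-! ### Mutual information along the Markov chain -/

section MutualInformation

variable {Ω 𝒲 : Type*} [MeasurableSpace Ω] [MeasurableSpace 𝒲]

lemma mutualInfo_eq_lintegral (μ : Measure Ω) [IsProbabilityMeasure μ] {W : Ω → 𝒲} {Y : Ω → ℝ}
    (hW : Measurable W) (L : Kernel 𝒲 ℝ) [IsMarkovKernel L]
    (hL : μ.map (fun ω => (W ω, Y ω)) = μ.map W ⊗ₘ L) [IsFiniteMeasure (μ.map Y)] :
    mutualInfo μ W Y = ∫⁻ w, klDiv (L w) (μ.map Y) ∂(μ.map W) := by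
  have := Measure.isProbabilityMeasure_map hW.aemeasurable (μ := μ)
  rw [mutualInfo, hL, ← Measure.compProd_const, klDiv_compProd_right]
  simp

/-- The additive noise channel `x ↦ law of x + Z`. -/
noncomputable def shiftKernel (ν : Measure ℝ) : Kernel ℝ ℝ :=
  (Kernel.id ×ₖ Kernel.const ℝ ν).map fun x => x.1 + x.2

instance (ν : Measure ℝ) [IsProbabilityMeasure ν] : IsMarkovKernel (shiftKernel ν) :=
  Kernel.IsMarkovKernel.map _ measurable_add

lemma shiftKernel_apply (ν : Measure ℝ) [IsProbabilityMeasure ν] (x : ℝ) {B : Set ℝ}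
    (hB : MeasurableSet B) : shiftKernel ν x B = ν ((x + ·) ⁻¹' B) := by
  rw [shiftKernel, Kernel.map_apply' _ measurable_add _ hB, Kernel.prod_apply, Kernel.id_apply,
    Kernel.const_apply, Measure.dirac_prod, Measure.map_apply measurable_prodMk_left
      (measurable_add hB)]
  rfl

lemma compProd_shiftKernel_comap {α : Type*} [MeasurableSpace α] (ρ : Measure α)
    [IsFiniteMeasure ρ] (ν : Measure ℝ) [IsProbabilityMeasure ν] {g : α → ℝ} (hg : Measurable g) :
    ρ ⊗ₘ (shiftKernel ν).comap g hg = (ρ.prod ν).map fun x => (x.1, g x.1 + x.2) := by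
  have hT : Measurable fun x : α × ℝ => (x.1, g x.1 + x.2) := by fun_prop
  ext s hs
  rw [Measure.compProd_apply hs, Measure.map_apply hT hs, Measure.prod_apply (hT hs)]
  refine lintegral_congr fun a => ?_
  rw [Kernel.comap_apply, shiftKernel_apply ν _ (measurable_prodMk_left hs)]
  rfl

/-- The conditional law of `X + Z` given `W`, when `K` is the conditional law of `X`. -/
noncomputable def noisyKernel (K : Kernel 𝒲 ℝ) (ν : Measure ℝ) : Kernel 𝒲 ℝ :=
  (K ×ₖ Kernel.const 𝒲 ν).map fun x => x.1 + x.2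

instance (K : Kernel 𝒲 ℝ) [IsMarkovKernel K] (ν : Measure ℝ) [IsProbabilityMeasure ν] :
    IsMarkovKernel (noisyKernel K ν) :=
  Kernel.IsMarkovKernel.map _ measurable_add

lemma noisyKernel_apply (K : Kernel 𝒲 ℝ) [IsMarkovKernel K] (ν : Measure ℝ)
    [IsProbabilityMeasure ν] (w : 𝒲) : noisyKernel K ν w = (K w).conv ν := by
  rw [noisyKernel, Kernel.map_apply _ measurable_add, Kernel.prod_apply, Kernel.const_apply]
  rfl

variable {μ : Measure Ω} [IsProbabilityMeasure μ] {W : Ω → 𝒲} {X Z : Ω → ℝ} {ν : Measure ℝ}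
  [IsProbabilityMeasure ν]

lemma condDistrib_add_ae_eq (hX : Measurable X) (hZ : Measurable Z) (hν : μ.map Z = ν)
    (hXZ : IndepFun X Z μ) :
    condDistrib (fun ω => X ω + Z ω) X μ =ᵐ[μ.map X] shiftKernel ν := by
  refine condDistrib_ae_eq_of_measure_eq_compProd_of_measurable hX (hX.add hZ) ?_
  have h := compProd_shiftKernel_comap (μ.map X) ν (measurable_id (α := ℝ))
  rw [Kernel.comap_id] at h
  rw [h, ← hν, ← (indepFun_iff_map_prod_eq_prod_map_map hX.aemeasurable hZ.aemeasurable).1 hXZ,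
    Measure.map_map (by fun_prop) (by fun_prop)]
  rfl

/-- Independence of `X` and `Z` identifies the channel from `X` to `Y` as translation of `ν`; the
Markov property lets it act after conditioning on `W`, so `Y` given `W` has the conditional law of
`X` convolved with `ν`. -/
lemma map_prodMk_add_eq_compProd (hW : Measurable W) (hX : Measurable X) (hZ : Measurable Z)
    (hν : μ.map Z = ν) (hXZ : IndepFun X Z μ)
    (hM : IsMarkovChain μ W X fun ω => X ω + Z ω) :
    μ.map (fun ω => (W ω, X ω + Z ω)) = μ.map W ⊗ₘ noisyKernel (condDistrib X W μ) ν := by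
  have hWX : Measurable fun ω => (W ω, X ω) := hW.prodMk hX
  have hjoint : μ.map (fun ω => ((W ω, X ω), X ω + Z ω)) =
      ((μ.map fun ω => (W ω, X ω)).prod ν).map fun x => (x.1, x.1.2 + x.2) := by
    rw [← compProd_shiftKernel_comap _ ν (measurable_snd (α := 𝒲) (β := ℝ))]
    refine hM.trans (Measure.compProd_congr ?_)
    have h := condDistrib_add_ae_eq hX hZ hν hXZ
    have hsnd : μ.map X = (μ.map fun ω => (W ω, X ω)).map Prod.snd := by
      rw [Measure.map_map measurable_snd hWX]; rfl
    rw [hsnd] at h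
    filter_upwards [ae_of_ae_map measurable_snd.aemeasurable h] with x hx
    rw [Kernel.comap_apply, Kernel.comap_apply, hx]
  have hWY : μ.map (fun ω => (W ω, X ω + Z ω)) =
      ((μ.map fun ω => (W ω, X ω)).prod ν).map fun x => (x.1.1, x.1.2 + x.2) := by
    calc μ.map (fun ω => (W ω, X ω + Z ω)) =
          (μ.map (fun ω => ((W ω, X ω), X ω + Z ω))).map fun x => (x.1.1, x.2) := by
          rw [Measure.map_map (by fun_prop) (by fun_prop)]; rfl
      _ = _ := by
          rw [hjoint, Measure.map_map (by fun_prop) (by fun_prop)]; rfl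
  have hT : Measurable fun x : (𝒲 × ℝ) × ℝ => (x.1.1, x.1.2 + x.2) := by fun_prop
  have := Measure.isProbabilityMeasure_map hW.aemeasurable (μ := μ)
  rw [hWY, ← compProd_map_condDistrib (X := W) hX.aemeasurable]
  ext s hs
  rw [Measure.map_apply hT hs, Measure.prod_apply (hT hs), Measure.lintegral_compProd
    (measurable_measure_prodMk_left (hT hs)), Measure.compProd_apply hs]
  refine lintegral_congr fun w => ?_
  rw [noisyKernel_apply, Measure.conv, Measure.map_apply measurable_add
    (measurable_prodMk_left hs), Measure.prod_apply (measurable_add (measurable_prodMk_left hs))]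
  rfl

lemma mutualInfo_input_eq (hW : Measurable W) (hX : Measurable X) :
    mutualInfo μ W X = ∫⁻ w, klDiv (condDistrib X W μ w) (μ.map X) ∂(μ.map W) :=
  mutualInfo_eq_lintegral μ hW _ (compProd_map_condDistrib hX.aemeasurable).symm

lemma mutualInfo_output_eq (hW : Measurable W) (hX : Measurable X) (hZ : Measurable Z)
    (hν : μ.map Z = ν) (hXZ : IndepFun X Z μ)
    (hM : IsMarkovChain μ W X fun ω => X ω + Z ω) :
    mutualInfo μ W (fun ω => X ω + Z ω) =
      ∫⁻ w, klDiv ((condDistrib X W μ w).conv ν) ((μ.map X).conv ν) ∂(μ.map W) := by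
  have hsum : μ.map (fun ω => X ω + Z ω) = (μ.map X).conv ν := by
    rw [← hν]
    exact hXZ.map_add_eq_map_conv_map hX hZ
  rw [mutualInfo_eq_lintegral μ hW _ (map_prodMk_add_eq_compProd hW hX hZ hν hXZ hM), hsum]
  simp_rw [noisyKernel_apply]

lemma mutualInfo_output_le (hW : Measurable W) (hX : Measurable X) (hZ : Measurable Z)
    (hν : μ.map Z = ν) (hXZ : IndepFun X Z μ)
    (hM : IsMarkovChain μ W X fun ω => X ω + Z ω) :
    mutualInfo μ W (fun ω => X ω + Z ω) ≤ mutualInfo μ W X := by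
  rw [mutualInfo_output_eq hW hX hZ hν hXZ hM, mutualInfo_input_eq hW hX]
  exact lintegral_mono fun w => klDiv_conv_le _ _ _

/-- Strong data processing after quantization of the input with cells of length `2a`. -/
lemma mutualInfo_output_add_le (hW : Measurable W) (hX : Measurable X) (hZ : Measurable Z)
    (hν : μ.map Z = ν) (hXZ : IndepFun X Z μ)
    (hM : IsMarkovChain μ W X fun ω => X ω + Z ω) {a p γ m : ℝ} (ha : 0 < a) (hp : 1 ≤ p)
    (hmom : ∫⁻ ω, ENNReal.ofReal (|X ω| ^ p) ∂μ ≤ ENNReal.ofReal γ) (hm0 : 0 < m)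
    (hm : m ≤ 1 / 2) (hγ : 0 ≤ γ) (hγm : γ / a ^ p ≤ m) :
    mutualInfo μ W (fun ω => X ω + Z ω) + ENNReal.ofReal (1 - eta ν a) * mutualInfo μ W X ≤
      mutualInfo μ W X +
        ENNReal.ofReal (1 - eta ν a) * ENNReal.ofReal (m * (-Real.log m + 4)) := by
  have := Measure.isProbabilityMeasure_map hW.aemeasurable (μ := μ)
  have := Measure.isProbabilityMeasure_map hX.aemeasurable (μ := μ)
  rw [mutualInfo_output_eq hW hX hZ hν hXZ hM, mutualInfo_input_eq hW hX]
  refine lintegral_klDiv_conv_add_le (μ.map W) _ (μ.map X) ν ?_ ha hp ?_ hm0 hm hγ hγm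
  · intro B hB
    rw [← Measure.bind_apply hB (Kernel.aemeasurable _), condDistrib_comp_map hW.aemeasurable
      hX.aemeasurable]
  · rwa [lintegral_map (by fun_prop) hX]

lemma toReal_mutualInfo_output_le (hW : Measurable W) (hX : Measurable X) (hZ : Measurable Z)
    (hν : μ.map Z = ν) (hXZ : IndepFun X Z μ)
    (hM : IsMarkovChain μ W X fun ω => X ω + Z ω) {a p γ m : ℝ} (ha : 0 < a) (hp : 1 ≤ p)
    (hmom : ∫⁻ ω, ENNReal.ofReal (|X ω| ^ p) ∂μ ≤ ENNReal.ofReal γ) (hm0 : 0 < m)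
    (hm : m ≤ 1 / 2) (hγ : 0 ≤ γ) (hγm : γ / a ^ p ≤ m) (hfin : mutualInfo μ W X ≠ ∞) :
    (mutualInfo μ W (fun ω => X ω + Z ω)).toReal +
        (1 - eta ν a) * (mutualInfo μ W X).toReal ≤
      (mutualInfo μ W X).toReal + (1 - eta ν a) * (m * (-Real.log m + 4)) := by
  have h := mutualInfo_output_add_le hW hX hZ hν hXZ hM ha hp hmom hm0 hm hγ hγm
  have hY := ((mutualInfo_output_le hW hX hZ hν hXZ hM).trans_lt hfin.lt_top).ne
  have he : 0 ≤ 1 - eta ν a := sub_nonneg.2 (eta_le_one ν a)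
  have hlog : 0 ≤ -Real.log m := neg_nonneg.2 (Real.log_nonpos hm0.le (by linarith))
  have h' := ENNReal.toReal_mono (by finiteness) h
  rwa [ENNReal.toReal_add hY (by finiteness), ENNReal.toReal_add hfin (by finiteness),
    ENNReal.toReal_mul, ENNReal.toReal_mul, ENNReal.toReal_ofReal he,
    ENNReal.toReal_ofReal (by positivity)] at h'

end MutualInformation

/-! ### The threshold `A₂*` and the resulting entropy bounds -/

section Threshold

/-- The infimum is attained: the constraint `A^p ≥ e` confines `A` to `[1, ∞)`, where both
conditions are closed, and they hold for large `A` because `log x / x → 0`. -/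
lemma A2Star_spec (ν : Measure ℝ) {p γ t : ℝ} (hp : 1 ≤ p) (ht : 0 < t) :
    0 < A2Star ν p γ t ∧
      18 * γ * A2Star ν p γ t ^ (-p) * Real.log (A2Star ν p γ t ^ p) ≤ t ∧
      max (Real.exp 1) (max (2 * γ) (alphaStar ν * Real.exp 3 / γ)) ≤ A2Star ν p γ t ^ p := by
  have hp0 : 0 < p := by linarith
  set M := max (Real.exp 1) (max (2 * γ) (alphaStar ν * Real.exp 3 / γ)) with hM
  set S : Set ℝ := {A : ℝ | 0 < A ∧ 18 * γ * A ^ (-p) * Real.log (A ^ p) ≤ t ∧ M ≤ A ^ p} with hS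
  have hS1 : S = (Set.Ici 1 ∩ (fun A : ℝ => 18 * γ * A ^ (-p) * Real.log (A ^ p)) ⁻¹' Set.Iic t) ∩
      (Set.Ici 1 ∩ (fun A : ℝ => A ^ p) ⁻¹' Set.Ici M) := by
    ext A
    constructor
    · rintro ⟨h0, h1, h2⟩
      have hA : 1 ≤ A := by
        by_contra hlt
        have h3 := Real.rpow_lt_one h0.le (not_le.1 hlt) hp0
        have h4 : Real.exp 1 ≤ A ^ p := (le_max_left _ _).trans h2
        have h5 := Real.add_one_le_exp (1 : ℝ)
        linarith
      exact ⟨⟨hA, h1⟩, hA, h2⟩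
    · rintro ⟨⟨h0, h1⟩, -, h2⟩
      exact ⟨zero_lt_one.trans_le h0, h1, h2⟩
  have hne : ∀ A ∈ Set.Ici (1 : ℝ), A ≠ 0 := fun A hA => (zero_lt_one.trans_le hA).ne'
  have hc : ∀ q : ℝ, ContinuousOn (fun A : ℝ => A ^ q) (Set.Ici 1) := fun q =>
    continuousOn_id.rpow_const fun A hA => Or.inl (hne A hA)
  have hclosed : IsClosed S := by
    rw [hS1]
    refine IsClosed.inter ?_ ((hc p).preimage_isClosed_of_isClosed isClosed_Ici isClosed_Ici)
    refine ContinuousOn.preimage_isClosed_of_isClosed ?_ isClosed_Ici isClosed_Iic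
    exact (continuousOn_const.mul (hc _)).mul ((hc p).log fun A hA =>
      (Real.rpow_pos_of_pos (zero_lt_one.trans_le hA) p).ne')
  have hnonempty : S.Nonempty := by
    have hlim : Filter.Tendsto (fun x : ℝ => 18 * γ * (Real.log x / x)) Filter.atTop (nhds 0) := by
      simpa using (Real.isLittleO_log_id_atTop.tendsto_div_nhds_zero).const_mul (18 * γ)
    obtain ⟨x, hx1, hx2, hx3⟩ := ((hlim.eventually (ge_mem_nhds ht)).and
      ((Filter.eventually_ge_atTop M).and (Filter.eventually_gt_atTop 0))).exists
    have hxp : (x ^ (1 / p)) ^ p = x := by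
      rw [← Real.rpow_mul hx3.le, one_div_mul_cancel hp0.ne', Real.rpow_one]
    refine ⟨x ^ (1 / p), Real.rpow_pos_of_pos hx3 _, ?_, ?_⟩
    · rw [Real.rpow_neg (Real.rpow_nonneg hx3.le _), hxp]
      calc _ = 18 * γ * (Real.log x / x) := by ring
        _ ≤ t := hx1
    · rwa [hxp]
  exact hclosed.csInf_mem hnonempty ⟨0, fun A hA => hA.1.le⟩

lemma entropy_bound_of_large {γ x t : ℝ} (hγ : 0 < γ) (hx : Real.exp 1 ≤ x)
    (ht : 18 * γ * x⁻¹ * Real.log x ≤ t) (hlog : -Real.log γ ≤ 4 * Real.log x) :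
    γ / x * (-Real.log (γ / x) + 4) ≤ t / 2 := by
  have hx0 : 0 < x := (Real.exp_pos 1).trans_le hx
  have hL : 1 ≤ Real.log x := (Real.le_log_iff_exp_le hx0).2 hx
  rw [Real.log_div hγ.ne' hx0.ne']
  have hm : 0 < γ / x := by positivity
  have h1 : γ / x * (-(Real.log γ - Real.log x) + 4) ≤ γ / x * (9 * Real.log x) := by
    refine mul_le_mul_of_nonneg_left ?_ hm.le
    -- Since `1 ≤ log x`, the bracket is at most `(4 + 1 + 4) log x`; doubling `9` gives the `18` in
    -- `A₂*`.
    linarith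
  have h2 : 18 * γ * x⁻¹ * Real.log x = 2 * (γ / x * (9 * Real.log x)) := by ring
  linarith

/-- Here `γ x⁴ < 1`. The quantity `γ² x / 2` is `γ / a` for the cell half-length `a = 2 / (γ x)`;
its logarithmic factor costs at most `4 / √γ`, which `√γ x² < 1` absorbs. -/
lemma entropy_bound_of_small {γ x t : ℝ} (hγ : 0 < γ) (hx : Real.exp 1 ≤ x)
    (ht : 18 * γ * x⁻¹ * Real.log x ≤ t) (hlog : 4 * Real.log x < -Real.log γ) :
    γ * x ≤ 1 ∧ γ ≤ 1 ∧
      γ ^ 2 * x / 2 * (-Real.log (γ ^ 2 * x / 2) + 4) ≤ t / 4 := by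
  have hx0 : 0 < x := (Real.exp_pos 1).trans_le hx
  have hx1 : 1 ≤ x := (Real.one_le_exp zero_le_one).trans hx
  have hL : 1 ≤ Real.log x := (Real.le_log_iff_exp_le hx0).2 hx
  have hγx : γ * x ^ 4 < 1 := by
    rw [← Real.log_neg_iff (by positivity), Real.log_mul hγ.ne' (by positivity), Real.log_pow]
    push_cast
    linarith
  have hx4 : x ≤ x ^ 4 := le_self_pow₀ hx1 (by norm_num)
  have h1 : γ * x ≤ 1 := by nlinarith
  have h2 : γ ≤ 1 := by nlinarith
  refine ⟨h1, h2, ?_⟩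
  set s := √γ with hs
  have hs0 : 0 < s := Real.sqrt_pos.2 hγ
  have hss : γ = s ^ 2 := (Real.sq_sqrt hγ.le).symm
  have hsx : s * x ^ 2 < 1 := by
    rw [← abs_of_pos (by positivity : 0 < s * x ^ 2), ← sq_lt_one_iff_abs_lt_one, mul_pow, ← hss]
    calc γ * (x ^ 2) ^ 2 = γ * x ^ 4 := by ring
      _ < 1 := hγx
  have hG : -Real.log γ + 2 ≤ 2 / s := by
    have := Real.log_le_sub_one_of_pos (inv_pos.2 hs0)
    rw [Real.log_inv] at this
    rw [hss, Real.log_pow, div_eq_mul_inv]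
    push_cast
    linarith
  have hl2 : Real.log 2 ≤ 1 := by linarith [Real.log_two_lt_d9]
  have hm : -Real.log (γ ^ 2 * x / 2) ≤ 2 * -Real.log γ := by
    rw [Real.log_div (by positivity) two_ne_zero, Real.log_mul (by positivity) hx0.ne',
      Real.log_pow]
    push_cast
    linarith
  calc γ ^ 2 * x / 2 * (-Real.log (γ ^ 2 * x / 2) + 4)
      ≤ γ ^ 2 * x / 2 * (2 * (2 / s)) := by
        refine mul_le_mul_of_nonneg_left ?_ (by positivity)
        linarith
    _ = 2 * (s * x ^ 2) * (γ * x⁻¹) := by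
        rw [hss]; field_simp
    _ ≤ 2 * 1 * (γ * x⁻¹) := by gcongr
    _ ≤ 18 / 4 * (γ * x⁻¹) * Real.log x := by
        have : 0 < γ * x⁻¹ := by positivity
        nlinarith
    _ ≤ t / 4 := by linarith

end Threshold

/-! ### The inequality with gap `g_d` -/

section Main

variable {pZ : ℝ → ℝ}

lemma eta_le_third_of_alphaStar_lt (hmeas : Measurable pZ) (hnonneg : ∀ z, 0 ≤ pZ z)
    (hprob : ∫⁻ z, ENNReal.ofReal (pZ z) = 1) {α : ℝ} (hα : alphaStar (noiseLaw pZ) < α) :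
    eta (noiseLaw pZ) (1 / (2 * α)) ≤ 1 / 3 := by
  have := isProbabilityMeasure_noiseLaw hprob
  obtain ⟨a, ha, hae⟩ := exists_eta_le hmeas hnonneg hprob (ε := 1 / 3) (by norm_num)
  have hne : {α : ℝ | 0 < α ∧ eta (noiseLaw pZ) (1 / (2 * α)) ≤ 1 / 3}.Nonempty := by
    refine ⟨1 / (2 * a), by positivity, ?_⟩
    rwa [show 1 / (2 * (1 / (2 * a))) = a by field_simp]
  obtain ⟨α', ⟨h0, h1⟩, h2⟩ := exists_lt_of_csInf_lt hne hα
  refine (eta_mono _ ?_).trans h1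
  gcongr

theorem nonlinearSDPI_gd {p γ : ℝ} (hp : 1 ≤ p) (hγ : 0 < γ)
    (hmeas : Measurable pZ) (hnonneg : ∀ z, 0 ≤ pZ z)
    (hprob : ∫⁻ z, ENNReal.ofReal (pZ z) = 1) :
    NonlinearSDPI.{u, v} (noiseLaw pZ) p γ (gd (noiseLaw pZ) p γ) := by
  intro Ω 𝒲 _ _ μ _ W X Z hW hX hZ hν hXZ hM hmom
  have := isProbabilityMeasure_noiseLaw hprob
  set ν := noiseLaw pZ with hνdef
  by_cases hfin : mutualInfo μ W X = ∞
  · rw [hfin]; exact le_top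
  have hle := mutualInfo_output_le hW hX hZ hν hXZ hM
  have hYfin := (hle.trans_lt (lt_top_iff_ne_top.2 hfin)).ne
  by_cases h0 : mutualInfo μ W X = 0
  -- At `t = 0` the gap vanishes through its factor `t`, so plain data processing suffices.
  · simpa [h0, gd] using hle
  set t := (mutualInfo μ W X).toReal with ht
  have ht0 : 0 < t := ENNReal.toReal_pos h0 hfin
  obtain ⟨hA0, hA1, hA2⟩ := A2Star_spec ν (γ := γ) hp ht0
  have hgd0 : 0 ≤ gd ν p γ t := by
    unfold gd
    have := sub_nonneg.2 (eta_le_one ν (A2Star ν p γ t))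
    positivity
  suffices h : (mutualInfo μ W fun ω => X ω + Z ω).toReal + gd ν p γ t ≤ t by
    rw [← ENNReal.ofReal_toReal hYfin, ← ENNReal.ofReal_add ENNReal.toReal_nonneg hgd0,
      ← ENNReal.ofReal_toReal hfin]
    exact ENNReal.ofReal_le_ofReal h
  unfold gd
  set A := A2Star ν p γ t with hA
  rw [Real.rpow_neg hA0.le] at hA1
  set x := A ^ p with hx
  have hxe : Real.exp 1 ≤ x := (le_max_left _ _).trans hA2
  have hxγ : 2 * γ ≤ x := (le_max_left _ _).trans ((le_max_right _ _).trans hA2)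
  have hxα : alphaStar ν * Real.exp 3 / γ ≤ x :=
    (le_max_right _ _).trans ((le_max_right _ _).trans hA2)
  have hx0 : 0 < x := (Real.exp_pos 1).trans_le hxe
  have hηA1 := eta_le_one ν A
  have hηA0 := eta_nonneg ν A
  rcases le_or_gt (-Real.log γ) (4 * Real.log x) with hcase | hcase
  · have hent := entropy_bound_of_large hγ hxe hA1 hcase
    have h := toReal_mutualInfo_output_le hW hX hZ hν hXZ hM hA0 hp hmom (m := γ / x)
      (by positivity) (by rw [div_le_iff₀ hx0]; linarith) hγ.le le_rfl hfin
    have := mul_le_mul_of_nonneg_left hent (sub_nonneg.2 hηA1)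
    rw [← ht] at h
    linarith
  · obtain ⟨hγx, hγ1, hent⟩ := entropy_bound_of_small hγ hxe hA1 hcase
    -- `e³ > 4` turns the constraint `α* e³ / γ ≤ x` into a strict inequality; with `α = γ x / 4`,
    -- the half-length `1 / (2α)` is exactly `2 / (γ x)`.
    have hα : alphaStar ν < γ * x / 4 := by
      rw [div_le_iff₀ hγ] at hxα
      have h4 : 4 < Real.exp 3 := by
        have := Real.add_one_lt_exp (x := 3) (by norm_num)
        linarith
      have : 0 < γ * x := by positivity
      rcases le_or_gt (alphaStar ν) 0 with h | h
      · linarith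
      · nlinarith
    have hη := eta_le_third_of_alphaStar_lt hmeas hnonneg hprob hα
    rw [show 1 / (2 * (γ * x / 4)) = 2 / (γ * x) by field_simp; norm_num, ← hνdef] at hη
    set a := 2 / (γ * x) with ha
    have ha1 : 1 ≤ a := by rw [ha, le_div_iff₀ (by positivity)]; linarith
    have ha0 : 0 < a := by linarith
    have hap : a ≤ a ^ p := by
      simpa using Real.rpow_le_rpow_of_exponent_le ha1 hp
    have h := toReal_mutualInfo_output_le hW hX hZ hν hXZ hM ha0 hp hmom (m := γ ^ 2 * x / 2)
      (by positivity) (by nlinarith) hγ.le (by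
        calc γ / a ^ p ≤ γ / a := by gcongr
          _ = γ ^ 2 * x / 2 := by rw [ha]; field_simp) hfin
    have := mul_le_mul_of_nonneg_left hent (sub_nonneg.2 (eta_le_one ν a))
    rw [← ht] at h
    -- The loss is at least `(1 - 1/3) (t - t/4) = t/2`, which dominates `g_d` because `η(A) ≥ 0`.
    nlinarith

end Main

/-! ### Converse: a binary input decoded without error -/

section Converse

lemma mutualInfo_comp_le {Ω α β δ : Type*} [MeasurableSpace Ω] [MeasurableSpace α]
    [MeasurableSpace β] [MeasurableSpace δ] (μ : Measure Ω) [IsFiniteMeasure μ] {U : Ω → α}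
    {V : Ω → β} (hU : Measurable U) (hV : Measurable V) {d : β → δ} (hd : Measurable d) :
    mutualInfo μ U (fun ω => d (V ω)) ≤ mutualInfo μ U V := by
  have hm : Measurable fun x : α × β => (x.1, d x.2) := by fun_prop
  have h1 : μ.map (fun ω => (U ω, d (V ω))) =
      (μ.map fun ω => (U ω, V ω)).map fun x => (x.1, d x.2) := by
    rw [Measure.map_map hm (by fun_prop)]; rfl
  have h2 : (μ.map U).prod (μ.map fun ω => d (V ω)) =
      ((μ.map U).prod (μ.map V)).map fun x => (x.1, d x.2) := by
    have := Measure.map_prod_map (μ.map U) (μ.map V) measurable_id hd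
    rw [Measure.map_id, Measure.map_map hd hV] at this
    exact this
  rw [mutualInfo, h1, h2]
  exact klDiv_map_le _ _ hm

lemma isMarkovChain_add {Ω 𝒲 : Type*} [MeasurableSpace Ω] [MeasurableSpace 𝒲] {μ : Measure Ω}
    [IsProbabilityMeasure μ] {W : Ω → 𝒲} {X Z : Ω → ℝ} (hW : Measurable W) (hX : Measurable X)
    (hZ : Measurable Z) (h : IndepFun (fun ω => (W ω, X ω)) Z μ) :
    IsMarkovChain μ W X fun ω => X ω + Z ω := by
  have hν := Measure.isProbabilityMeasure_map hZ.aemeasurable (μ := μ)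
  have hWX : Measurable fun ω => (W ω, X ω) := hW.prodMk hX
  have hXZ : IndepFun X Z μ := h.comp measurable_snd measurable_id
  have hcongr : (μ.map fun ω => (W ω, X ω)) ⊗ₘ
      (condDistrib (fun ω => X ω + Z ω) X μ).comap Prod.snd measurable_snd =
      (μ.map fun ω => (W ω, X ω)) ⊗ₘ (shiftKernel (μ.map Z)).comap Prod.snd measurable_snd := by
    refine Measure.compProd_congr ?_
    have h := condDistrib_add_ae_eq hX hZ rfl hXZ
    have hsnd : μ.map X = (μ.map fun ω => (W ω, X ω)).map Prod.snd := by
      rw [Measure.map_map measurable_snd hWX]; rfl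
    rw [hsnd] at h
    filter_upwards [ae_of_ae_map measurable_snd.aemeasurable h] with x hx
    rw [Kernel.comap_apply, Kernel.comap_apply, hx]
  rw [IsMarkovChain, hcongr, compProd_shiftKernel_comap,
    ← (indepFun_iff_map_prod_eq_prod_map_map hWX.aemeasurable hZ.aemeasurable).1 h,
    Measure.map_map (by fun_prop) (by fun_prop)]
  rfl

/-- The law of a biased coin with values in `ULift Bool`. -/
noncomputable def coin (ε : ℝ) : Measure (ULift.{v} Bool) :=
  ENNReal.ofReal (1 - ε) • Measure.dirac ⟨false⟩ + ENNReal.ofReal ε • Measure.dirac ⟨true⟩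

instance : DiscreteMeasurableSpace (ULift.{v} Bool) :=
  ⟨fun s => MeasurableSet.of_discrete (s := ULift.up ⁻¹' s)⟩

lemma isProbabilityMeasure_coin {ε : ℝ} (h0 : 0 ≤ ε) (h1 : ε ≤ 1) :
    IsProbabilityMeasure (coin.{v} ε) := by
  refine ⟨?_⟩
  simp only [coin, Measure.add_apply, Measure.smul_apply, measure_univ, smul_eq_mul, mul_one]
  rw [← ENNReal.ofReal_add (by linarith) h0]
  simp

lemma coin_singleton_pos {ε : ℝ} (h0 : 0 < ε) (h1 : ε < 1) (b : ULift.{v} Bool) :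
    coin.{v} ε {b} ≠ 0 := by
  have h1' : 0 < 1 - ε := by linarith
  rcases b with ⟨_ | _⟩ <;> simp [coin, h0, h1]

/-- The product law charges all four points, so absolute continuity is automatic and the divergence
is finite; the diagonal law misses `(false, true)`, so the two laws differ. -/
lemma mutualInfo_self_coin {Ω : Type*} [MeasurableSpace Ω] {μ : Measure Ω}
    [IsProbabilityMeasure μ] {W : Ω → ULift.{v} Bool} (hW : Measurable W) {ε : ℝ} (h0 : 0 < ε)
    (h1 : ε < 1) (hlaw : μ.map W = coin ε) :
    mutualInfo μ W W ≠ 0 ∧ mutualInfo μ W W ≠ ∞ := by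
  have := isProbabilityMeasure_coin.{v} h0.le h1.le
  have hWW : Measurable fun ω => (W ω, W ω) := hW.prodMk hW
  have hpos : ∀ x : ULift.{v} Bool × ULift.{v} Bool,
      ((μ.map W).prod (μ.map W)) {x} ≠ 0 := by
    rintro ⟨b, c⟩
    rw [hlaw, ← Set.singleton_prod_singleton, Measure.prod_prod]
    exact mul_ne_zero (coin_singleton_pos h0 h1 b) (coin_singleton_pos h0 h1 c)
  constructor
  · intro h
    have := Measure.isProbabilityMeasure_map hW.aemeasurable (μ := μ)
    rw [mutualInfo, klDiv_eq_zero_iff] at h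
    refine hpos (⟨false⟩, ⟨true⟩) ?_
    rw [← h, Measure.map_apply hWW (MeasurableSet.singleton _)]
    have : (fun ω => (W ω, W ω)) ⁻¹' {(⟨false⟩, ⟨true⟩)} = ∅ := by
      ext ω
      simp only [Set.mem_preimage, Set.mem_singleton_iff, Prod.mk.injEq, Set.mem_empty_iff_false,
        iff_false, not_and]
      intro h
      simp [h]
    rw [this, measure_empty]
  · refine klDiv_ne_top ?_ Integrable.of_finite
    intro s hs
    have : s = ∅ := by
      by_contra hne
      obtain ⟨x, hx⟩ := Set.nonempty_iff_ne_empty.2 hne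
      exact hpos x (measure_mono_null (Set.singleton_subset_iff.2 hx) hs)
    rw [this, measure_empty]

variable {pZ : ℝ → ℝ}

lemma volume_inter_translate_pos_of_sdpi {p γ : ℝ} (hp : 1 ≤ p) (hγ : 0 < γ)
    (hmeas : Measurable pZ) (hprob : ∫⁻ z, ENNReal.ofReal (pZ z) = 1) {g : ℝ → ℝ}
    (hg : ∀ t, 0 < t → 0 < g t) (hsdpi : NonlinearSDPI.{u, v} (noiseLaw pZ) p γ g) (x : ℝ) :
    0 < volume ({z | 0 < pZ z} ∩ (fun z => z + x) '' {z | 0 < pZ z}) := by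
  by_contra hvol
  replace hvol := nonpos_iff_eq_zero.1 (not_lt.1 hvol)
  have hνprob := isProbabilityMeasure_noiseLaw hprob
  have hS : MeasurableSet {z | 0 < pZ z} := measurableSet_lt measurable_const hmeas
  have hfalse : noiseLaw pZ {z | 0 < pZ z}ᶜ = 0 :=
    (prob_compl_eq_zero_iff hS).2 (noiseLaw_support hmeas hprob)
  have htrue := noiseLaw_preimage_support_eq_zero hmeas hprob hvol
  obtain ⟨ε, hε0, hε1, hεx⟩ : ∃ ε : ℝ, 0 < ε ∧ ε < 1 ∧ ε * |x| ^ p ≤ γ := by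
    have hx : 0 ≤ |x| ^ p := by positivity
    refine ⟨min (1 / 2) (γ / (|x| ^ p + 1)), by positivity,
      (min_le_left _ _).trans_lt (by norm_num), ?_⟩
    calc _ ≤ γ / (|x| ^ p + 1) * |x| ^ p := by gcongr; exact min_le_right _ _
      _ ≤ γ := by
        rw [div_mul_eq_mul_div, div_le_iff₀ (by positivity)]
        nlinarith
  have hcoin := isProbabilityMeasure_coin.{v} hε0.le hε1.le
  set ν := noiseLaw pZ
  -- The lifts place the sample space in `Type u` and the message alphabet in `Type v`, as
  -- `NonlinearSDPI` demands.
  set μ : Measure (ULift.{u} (Bool × ℝ)) :=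
    (((coin.{v} ε).map ULift.down).prod ν).map ULift.up with hμ
  have hdown : Measurable (ULift.down : ULift.{v} Bool → Bool) := measurable_down
  have hup : Measurable (ULift.up : Bool → ULift.{v} Bool) := measurable_up
  have hupΩ : Measurable (ULift.up : Bool × ℝ → ULift.{u} (Bool × ℝ)) := measurable_up
  have hdownΩ : Measurable (ULift.down : ULift.{u} (Bool × ℝ) → Bool × ℝ) := measurable_down
  have := Measure.isProbabilityMeasure_map hdown.aemeasurable (μ := coin.{v} ε)
  have hμprob : IsProbabilityMeasure μ := Measure.isProbabilityMeasure_map hupΩ.aemeasurable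
  let W : ULift.{u} (Bool × ℝ) → ULift.{v} Bool := fun ω => ⟨ω.down.1⟩
  let Z : ULift.{u} (Bool × ℝ) → ℝ := fun ω => ω.down.2
  let f : ULift.{v} Bool → ℝ := fun b => if b.down then x else 0
  have hf : Measurable f := Measurable.of_discrete
  have hW : Measurable W := hup.comp (measurable_fst.comp hdownΩ)
  have hZ : Measurable Z := measurable_snd.comp hdownΩ
  have hX : Measurable fun ω => f (W ω) := hf.comp hW
  have hjoint : μ.map (fun ω => (W ω, Z ω)) = (coin.{v} ε).prod ν := by
    have h1 := Measure.map_prod_map ((coin.{v} ε).map ULift.down) ν hup measurable_id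
    rw [Measure.map_map hup hdown, Measure.map_id] at h1
    have h2 : (ULift.up ∘ ULift.down : ULift.{v} Bool → ULift.{v} Bool) = id := rfl
    rw [h2, Measure.map_id] at h1
    rw [h1, hμ, Measure.map_map (hW.prodMk hZ) hupΩ]
    rfl
  have hWlaw : μ.map W = coin ε := by
    calc μ.map W = (μ.map fun ω => (W ω, Z ω)).map Prod.fst := by
          rw [Measure.map_map measurable_fst (hW.prodMk hZ)]; rfl
      _ = coin ε := by rw [hjoint, Measure.map_fst_prod]; simp
  have hZlaw : μ.map Z = ν := by
    calc μ.map Z = (μ.map fun ω => (W ω, Z ω)).map Prod.snd := by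
          rw [Measure.map_map measurable_snd (hW.prodMk hZ)]; rfl
      _ = ν := by rw [hjoint, Measure.map_snd_prod]; simp
  have hWZ : IndepFun W Z μ := by
    rw [indepFun_iff_map_prod_eq_prod_map_map hW.aemeasurable hZ.aemeasurable, hjoint, hWlaw,
      hZlaw]
  have hWXZ : IndepFun (fun ω => (W ω, f (W ω))) Z μ :=
    hWZ.comp (measurable_id.prodMk hf) measurable_id
  have hmom : ∫⁻ ω, ENNReal.ofReal (|f (W ω)| ^ p) ∂μ ≤ ENNReal.ofReal γ := by
    rw [← lintegral_map (f := fun b => ENNReal.ofReal (|f b| ^ p)) Measurable.of_discrete hW,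
      hWlaw, coin, lintegral_add_measure, lintegral_smul_measure, lintegral_smul_measure,
      lintegral_dirac, lintegral_dirac]
    have hp0 : (0 : ℝ) ^ p = 0 := Real.zero_rpow (by linarith)
    simp only [f, Bool.false_eq_true, if_false, if_true, abs_zero, hp0, ENNReal.ofReal_zero,
      smul_eq_mul, mul_zero, zero_add]
    rw [← ENNReal.ofReal_mul hε0.le]
    exact ENNReal.ofReal_le_ofReal hεx
  have hmain := hsdpi _ _ μ W (fun ω => f (W ω)) Z hW hX hZ hZlaw (hWZ.comp hf measurable_id)
    (isMarkovChain_add hW hX hZ hWXZ) hmom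
  classical
  -- Decoder: `Y` lies in the support almost surely when `X = 0`, and almost never when `X = x`.
  let d : ℝ → ULift.{v} Bool := fun y => if 0 < pZ y then ⟨false⟩ else ⟨true⟩
  have hd : Measurable d := Measurable.ite hS measurable_const measurable_const
  have hY : Measurable fun ω => f (W ω) + Z ω := hX.add hZ
  have hdecode : ∀ᵐ ω ∂μ, d (f (W ω) + Z ω) = W ω := by
    have hset : MeasurableSet {y : ULift.{v} Bool × ℝ | d (f y.1 + y.2) = y.1}ᶜ := by
      refine (measurableSet_eq_fun ?_ measurable_fst).compl
      exact hd.comp ((hf.comp measurable_fst).add measurable_snd)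
    have h : ∀ᵐ y ∂((coin.{v} ε).prod ν), d (f y.1 + y.2) = y.1 := by
      rw [ae_iff]
      refine (Measure.measure_prod_null hset).2 (Filter.Eventually.of_forall ?_)
      rintro ⟨_ | _⟩
      · refine measure_mono_null ?_ hfalse
        intro z hz hz'
        have hz0 : 0 < pZ z := hz'
        exact hz (by simp [f, d, hz0])
      · refine measure_mono_null ?_ htrue
        intro z hz
        by_contra hz'
        have hz0 : ¬ 0 < pZ (x + z) := hz'
        exact hz (by simp [f, d, hz0])
    rw [← hjoint] at h
    exact ae_of_ae_map (hW.prodMk hZ).aemeasurable h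
  obtain ⟨hI0, hItop⟩ := mutualInfo_self_coin hW hε0 hε1 hWlaw
  have hlow : mutualInfo μ W W ≤ mutualInfo μ W fun ω => f (W ω) + Z ω := by
    refine le_trans (le_of_eq ?_) (mutualInfo_comp_le μ hW hY hd)
    rw [mutualInfo, mutualInfo, Measure.map_congr hdecode]
    congr 1
    refine Measure.map_congr ?_
    filter_upwards [hdecode] with ω hω
    rw [hω]
  have hupp : mutualInfo μ W (fun ω => f (W ω)) ≤ mutualInfo μ W W :=
    mutualInfo_comp_le μ hW hW hf
  have hXtop : mutualInfo μ W (fun ω => f (W ω)) ≠ ∞ := (hupp.trans_lt hItop.lt_top).ne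
  have hXle : mutualInfo μ W (fun ω => f (W ω)) ≤ mutualInfo μ W fun ω => f (W ω) + Z ω :=
    hupp.trans hlow
  have hX0 : mutualInfo μ W (fun ω => f (W ω)) ≠ 0 := by
    intro h0
    have h1 := hlow.trans (le_self_add.trans (hmain.trans h0.le))
    exact hI0 (nonpos_iff_eq_zero.1 h1)
  have hgpos := hg _ (ENNReal.toReal_pos hX0 hXtop)
  refine absurd hmain (not_le.2 ?_)
  calc mutualInfo μ W (fun ω => f (W ω)) <
        mutualInfo μ W (fun ω => f (W ω)) +
          ENNReal.ofReal (g (mutualInfo μ W fun ω => f (W ω)).toReal) :=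
        ENNReal.lt_add_right hXtop (ENNReal.ofReal_pos.2 hgpos).ne'
    _ ≤ _ := by gcongr

end Converse

end AdditiveNoiseSDPI

theorem mainTheorem4 (p γ : ℝ) (hp : 1 ≤ p) (hγ : 0 < γ)
    (pZ : ℝ → ℝ) (hmeas : Measurable pZ) (hnonneg : ∀ z, 0 ≤ pZ z)
    (hprob : ∫⁻ z, ENNReal.ofReal (pZ z) = 1) :
    List.TFAE
      [ -- the inequality holds with the explicit gap `g_d`, and this gap is positive
        AdditiveNoiseSDPI.NonlinearSDPI.{u, v} (AdditiveNoiseSDPI.noiseLaw pZ) p γ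
            (AdditiveNoiseSDPI.gd (AdditiveNoiseSDPI.noiseLaw pZ) p γ) ∧
          ∀ t : ℝ, 0 < t → 0 < AdditiveNoiseSDPI.gd (AdditiveNoiseSDPI.noiseLaw pZ) p γ t,
        -- the inequality holds with some positive gap
        ∃ g : ℝ → ℝ, (∀ t : ℝ, 0 < t → 0 < g t) ∧
          AdditiveNoiseSDPI.NonlinearSDPI.{u, v} (AdditiveNoiseSDPI.noiseLaw pZ) p γ g,
        -- the support of the density meets each of its translates in positive measure
        ∀ x : ℝ, 0 < volume ({z | 0 < pZ z} ∩ (fun z => z + x) '' {z | 0 < pZ z}),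
        -- the noise is not perfectly distinguishable from any of its translates
        ∀ x : ℝ, AdditiveNoiseSDPI.tvDist (AdditiveNoiseSDPI.noiseLaw pZ)
          ((AdditiveNoiseSDPI.noiseLaw pZ).map fun z => z + x) ≠ 1 ] := by
  have hpos : (∀ x : ℝ, 0 < volume ({z | 0 < pZ z} ∩ (fun z => z + x) '' {z | 0 < pZ z})) →
      ∀ t : ℝ, 0 < t → 0 < AdditiveNoiseSDPI.gd (AdditiveNoiseSDPI.noiseLaw pZ) p γ t := by
    intro h t ht
    have hA := (AdditiveNoiseSDPI.A2Star_spec (AdditiveNoiseSDPI.noiseLaw pZ) (γ := γ) hp ht).1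
    have hη := AdditiveNoiseSDPI.eta_lt_one hmeas hnonneg hprob
      (fun x => (AdditiveNoiseSDPI.overlap_pos_iff hmeas hnonneg hprob x).2 (h x)) hA.le
    have := sub_pos.2 hη
    unfold AdditiveNoiseSDPI.gd
    positivity
  tfae_have 1 → 2 := fun h => ⟨_, h.2, h.1⟩
  tfae_have 2 → 3 := fun ⟨_, hg, h⟩ x =>
    AdditiveNoiseSDPI.volume_inter_translate_pos_of_sdpi hp hγ hmeas hprob hg h x
  tfae_have 3 → 1 := fun h =>
    ⟨AdditiveNoiseSDPI.nonlinearSDPI_gd hp hγ hmeas hnonneg hprob, hpos h⟩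
  tfae_have 3 ↔ 4 := forall_congr' fun x =>
    (AdditiveNoiseSDPI.tvDist_ne_one_iff hmeas hnonneg hprob x).symm
  tfae_finish
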